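/- Let $n\ge 1$ and $[0,n]=\{0,1,\dots,n\}$. **Skewed binary partitions.** A *skewed binary partition* of $[0,n]$ is a tuple $\mathcal B=(B_{-1},B_0,B_1,\dots,B_p)$, $p\ge 0$, of pairwise disjoint subsets with union $[0,n]$, each marked homogeneous or non-homogeneous, such that: $B_{-1}$ is non-homogeneous; $B_0$ is homogeneous if $|B_0|\ge 2$; $0\in B_{-1}\cup B_0$; if $0\in B_{-1}$, then $|B_{-1}|\ge 2$ and $B_0=\emptyset$; every block with at most one element is non-homogeneous; $B_i\ne\emptyset$ for $1\le i\le p$. Its preorder $\preceq_{\mathcal B}$ on $[0,n]$ is: $x\preceq_{\mathcal B} y$ iff $x=y$, or $x\in B_i$ and $y\in B_j$ with $i<j$, or $x,y$ lie in the same homogeneous block. A preorder is a *contraction* of another one if it is obtained from it by a finite (possibly empty) sequence of steps, each of which contracts an edge of the Hasse diagram of the poset of equivalence classes, that is, picks $x,y$ such that $y$ covers $x$, adds the relation $y\preceq x$ and takes the reflexive transitive closure. $\mathcal B$ is a contraction of $\mathcal A$ if $\preceq_{\mathcal B}$ is a contraction of $\preceq_{\mathcal A}$. **Types.** Besides plain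 numbers $i$ we use the symbols $i^\circ$ and $i^\star$ ($i\in\mathbb N$), with $|i|=|i^\circ|=|i^\star|=i$; the three symbols are different, in particular $0\ne 0^\circ$. Let $\mathbb P$ be the set of plain positive integers and $\mathbb P^\star=\{i^\star: i\ge 1\}$. A *skewed binary composition* of $n$ is a tuple $(b_{-1},b_0,\dots,b_p)$ with $\sum_i|b_i|=n$, such that either $b_{-1}\in\mathbb N$ and $b_0=h^\circ$ for some $h\in\mathbb N$, or $b_{-1}\in\mathbb P$ and $b_0=0$; and for $1\le i\le p$ either $b_i\in\mathbb P$ or $b_i=c^\star$ with $c\ge 2$. The *type* $\operatorname{type}(\mathcal B)=(b_{-1},b_0,\dots,b_p)$ is given by: for $1\le i\le p$, $b_i=|B_i|$ if $B_i$ is non-homogeneous and $b_i=|B_i|^\star$ if $B_i$ is homogeneous; if $0\in B_0$, then $b_{-1}=|B_{-1}|$ and $b_0=(|B_0|-1)^\circ$; if $0\in B_{-1}$, then $b_{-1}=|B_{-1}|-1$ and $b_0=0$. **Multiplicity vectors and $\mathcal{SBP}(\mathbf m)$.** $\mathbf m=(m_0,\dots,m_\ell)$ is a *multiplicity vector* of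 magnitude $n$ if there is a nonzero real vector $0\le u_1\le\dots\le u_n$ with exactly $\ell$ distinct positive entries $d_1<\dots<d_\ell$ such that $0$ occurs $m_0$ times and $d_i$ occurs $m_i$ times in it. Let $r=m_1+\dots+m_\ell$. Let $\Omega_{\mathbf m}=\{\mathbf a_0,\dots,\mathbf a_r\}$, where $\mathbf a_0=(m_0,0,m_1,\dots,m_\ell)$ if $m_0>0$ and $\mathbf a_0=(0,0^\circ,m_1,\dots,m_\ell)$ if $m_0=0$; for $1\le i<r$, $\mathbf a_i=(m_0+i,0^\circ,m_1+\dots+m_g-i,m_{g+1},\dots,m_\ell)$ with $g\in\{1,\dots,\ell\}$ determined by $m_1+\dots+m_{g-1}\le i<m_1+\dots+m_g$; and $\mathbf a_r=(n,0^\circ)$. $\mathcal{SBP}(\mathbf m)$ is the set of all skewed binary partitions of $[0,n]$ that are contractions of a skewed binary partition $\mathcal A$ of $[0,n]$ with $\operatorname{type}(\mathcal A)\in\Omega_{\mathbf m}$. **Proposition.** Let $\mathbf m=(m_0,\dots,m_\ell)$ be a multiplicity vector of magnitude $n$ and $\mathcal B$ a skewed binary partition of $[0,n]$. Then $\mathcal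 B\in\mathcal{SBP}(\mathbf m)$ if and only if $\operatorname{type}(\mathcal B)=(b_{-1},b_0,\dots,b_p)$ is a skewed binary composition of $n$ that satisfies the following conditions. 1. $0<|b_{-1}|+|b_0|\le m_0$ if and only if $b_0=0$. 2. $m_0<|b_{-1}|+|b_0|+|b_1|$ (read as $m_0<|b_{-1}|+|b_0|$ if $p=0$), and for every $i\in\{1,\dots,\ell\}$ there is at most one $j\in\{1,\dots,p\}$ such that $$m_0+\dots+m_{i-1}\le |b_{-1}|+\dots+|b_{j-1}|<|b_{-1}|+\dots+|b_j|\le m_0+\dots+m_i.\qquad(*)$$ 3. For every $j\in\{1,\dots,p\}$: if $(*)$ holds for some $i\in\{1,\dots,\ell\}$, then $b_j\in\mathbb P$; otherwise $b_j\in\mathbb P^\star$. -/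

import Mathlib

namespace ParkingFan

/-- The sum of the entries of the tuple `f` over the positions `a ≤ t < b` (positions counted
from `0`). -/
def segSum {N : ℕ} (f : Fin N → ℕ) (a b : ℕ) : ℕ :=
  ∑ t : Fin N with a ≤ t.val ∧ t.val < b, f t

/-! ### Preorders and their contractions -/

/-- `y` covers `x` in the preposet given by the preorder `r`: `x` is strictly below `y` and no
element is strictly between them, i.e. the class of `x` and the class of `y` are joined by an edge
of the Hasse diagram of the poset of equivalence classes. -/
def Covers {α : Type*} (r : α → α → Prop) (x y : α) : Prop :=
  (r x y ∧ ¬ r y x) ∧ ¬ ∃ z, (r x z ∧ ¬ r z x) ∧ (r z y ∧ ¬ r y z)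

/-- The preorder obtained from `r` by contracting the Hasse edge between the class of `x` and the
class of `y` (where `y` covers `x`): the two classes are merged, so that the relation `y ≤ x`
is added and the reflexive transitive closure is taken. -/
def contractEdge {α : Type*} (r : α → α → Prop) (x y : α) : α → α → Prop :=
  Relation.ReflTransGen (fun a b => r a b ∨ (a = y ∧ b = x))

/-- The preorder `s` is a contraction of the preorder `r`: it is obtained from `r` by a finite
(possibly empty) sequence of contractions of edges of Hasse diagrams. -/
def IsContraction {α : Type*} (s r : α → α → Prop) : Prop :=
  Relation.ReflTransGen
    (fun r₁ r₂ : α → α → Prop => ∃ x y, Covers r₁ x y ∧ r₂ = contractEdge r₁ x y) r s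

/-! ### Skewed binary partitions -/

/-- A skewed binary partition `(B_{-1}, B_0, …, B_p)` of `[0,n]`, where `[0,n]` is `Fin (n + 1)`.
Positions are shifted by one: `block 0` is `B_{-1}`, `block 1` is `B_0`, and in general
`block (j + 1)` is `B_j`. The flag `homog` tells which blocks are homogeneous; an empty block
carries the flag `false`. -/
structure SkewedBinaryPartition (n : ℕ) where
  p : ℕ
  block : Fin (p + 2) → Finset (Fin (n + 1))
  homog : Fin (p + 2) → Bool
  disjoint : ∀ i j, i ≠ j → Disjoint (block i) (block j)
  cover : ∀ x, ∃ i, x ∈ block i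
  first_nonhomog : homog 0 = false
  second_homog : 2 ≤ (block 1).card → homog 1 = true
  zero_mem : 0 ∈ block 0 ∨ 0 ∈ block 1
  zero_mem_first : 0 ∈ block 0 → 2 ≤ (block 0).card ∧ block 1 = ∅
  small_nonhomog : ∀ i, (block i).card ≤ 1 → homog i = false
  nonempty : ∀ i : Fin (p + 2), 2 ≤ i.val → (block i).Nonempty

/-- The preorder `⪯_B` on `[0,n]`: elements of earlier blocks are below elements of later blocks,
all elements of a homogeneous block are equivalent, and distinct elements of a non-homogeneous
block are incomparable. (Empty blocks have no influence.) -/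
def SkewedBinaryPartition.rel {n : ℕ} (B : SkewedBinaryPartition n) (x y : Fin (n + 1)) : Prop :=
  x = y ∨ (∃ i j, i < j ∧ x ∈ B.block i ∧ y ∈ B.block j) ∨
    ∃ i, B.homog i = true ∧ x ∈ B.block i ∧ y ∈ B.block i

/-! ### Skewed binary compositions and types -/

/-- Entries of skewed binary compositions: a plain number `i`, or one of its two decorated
variants `i°` and `i⋆`. -/
inductive Entry where
  | plain (i : ℕ)
  | circ (i : ℕ)
  | star (i : ℕ)

/-- The numerical value `|i| = |i°| = |i⋆| = i`. -/
def Entry.abs : Entry → ℕ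
  | .plain i => i
  | .circ i => i
  | .star i => i

/-- The entry is a plain positive integer. -/
def Entry.IsPos (e : Entry) : Prop := ∃ c, 0 < c ∧ e = .plain c

/-- The entry is a starred positive integer. -/
def Entry.IsPosStar (e : Entry) : Prop := ∃ c, 0 < c ∧ e = .star c

/-- `b = (b_{-1}, b_0, …, b_p)` is a skewed binary composition of `n`
(`b_j` stands at position `j + 1`). -/
def IsSkewedBinaryComposition (n : ℕ) {p : ℕ} (b : Fin (p + 2) → Entry) : Prop :=
  ∑ i, (b i).abs = n ∧
  ((∃ c h, b 0 = .plain c ∧ b 1 = .circ h) ∨ (∃ c, 0 < c ∧ b 0 = .plain c ∧ b 1 = .plain 0)) ∧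
  ∀ i : Fin (p + 2), 2 ≤ i.val →
    (∃ c, 1 ≤ c ∧ b i = .plain c) ∨ (∃ c, 2 ≤ c ∧ b i = .star c)

/-- The type `(b_{-1}, b_0, …, b_p)` of a skewed binary partition. -/
def SkewedBinaryPartition.type {n : ℕ} (B : SkewedBinaryPartition n) (i : Fin (B.p + 2)) : Entry :=
  if i = 0 then
    if 0 ∈ B.block 1 then .plain (B.block 0).card else .plain ((B.block 0).card - 1)
  else if i = 1 then
    if 0 ∈ B.block 1 then .circ ((B.block 1).card - 1) else .plain (B.block 1).card
  else
    if B.homog i = true then .star (B.block i).card else .plain (B.block i).card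

/-! ### Multiplicity vectors and `SBP(m)` -/

/-- `m = (m_0, …, m_ℓ)` is a multiplicity vector of magnitude `n`: there is a nonzero vector
`0 ≤ u_1 ≤ ⋯ ≤ u_n` whose distinct positive entries are `d_1 < ⋯ < d_ℓ`, such that `0` occurs `m_0`
times and `d_i` occurs `m_i` times in `u`. -/
def IsMultiplicityVector (n : ℕ) {ℓ : ℕ} (m : Fin (ℓ + 1) → ℕ) : Prop :=
  ∃ (u : Fin n → ℝ) (d : Fin ℓ → ℝ),
    Monotone u ∧ (∀ j, 0 ≤ u j) ∧ u ≠ 0 ∧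
    StrictMono d ∧ (∀ x : ℝ, x ∈ Set.range d ↔ 0 < x ∧ x ∈ Set.range u) ∧
    m 0 = Nat.card {j // u j = 0} ∧
    ∀ i : Fin ℓ, m i.succ = Nat.card {j // u j = d i}

/-- The set `Ω_m` of the skewed binary compositions `a_0, …, a_r`, `r = m_1 + ⋯ + m_ℓ`
(as lists of entries). -/
def Omega {ℓ : ℕ} (m : Fin (ℓ + 1) → ℕ) : Set (List Entry) :=
  { a |
    -- `a_0`
    (0 < m 0 ∧ a = .plain (m 0) :: .plain 0 :: ((List.ofFn m).drop 1).map .plain) ∨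
    (m 0 = 0 ∧ a = .plain 0 :: .circ 0 :: ((List.ofFn m).drop 1).map .plain) ∨
    -- `a_i` for `1 ≤ i < r`
    (∃ i g : ℕ, 1 ≤ i ∧ 1 ≤ g ∧ g ≤ ℓ ∧ segSum m 1 g ≤ i ∧ i < segSum m 1 (g + 1) ∧
      a = .plain (m 0 + i) :: .circ 0 :: .plain (segSum m 1 (g + 1) - i) ::
        ((List.ofFn m).drop (g + 1)).map .plain) ∨
    -- `a_r`
    a = [.plain (∑ t, m t), .circ 0] }

/-- `SBP(m)`: the skewed binary partitions of `[0,n]` that are contractions of a skewed binary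
partition whose type lies in `Ω_m`. -/
def SBP (n : ℕ) {ℓ : ℕ} (m : Fin (ℓ + 1) → ℕ) : Set (SkewedBinaryPartition n) :=
  { B | ∃ A : SkewedBinaryPartition n, List.ofFn A.type ∈ Omega m ∧ IsContraction B.rel A.rel }

/-! ### The inequalities between partial sums -/

/-- For positive `i ≤ ℓ` and `j ≤ p`:
`m_0 + ⋯ + m_{i-1} ≤ |b_{-1}| + ⋯ + |b_{j-1}| < |b_{-1}| + ⋯ + |b_j| ≤ m_0 + ⋯ + m_i`. -/
def Fits {ℓ p : ℕ} (m : Fin (ℓ + 1) → ℕ) (b : Fin (p + 2) → Entry) (i j : ℕ) : Prop :=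
  (1 ≤ i ∧ i ≤ ℓ) ∧ (1 ≤ j ∧ j ≤ p) ∧
  segSum m 0 i ≤ segSum (fun t => (b t).abs) 0 (j + 1) ∧
  segSum (fun t => (b t).abs) 0 (j + 1) < segSum (fun t => (b t).abs) 0 (j + 2) ∧
  segSum (fun t => (b t).abs) 0 (j + 2) ≤ segSum m 0 (i + 1)

end ParkingFan

/-!
A preorder `s ≥ r` is a contraction of `r` exactly when every relation of `s` is realised by a path
that follows relations of `r` or reverses those whose reversal belongs to `s`. If `r` is a chain of
antichains and `s` comes from a skewed binary partition `B`, this says that `s` extends `r`, that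
no homogeneous block of `B` lies inside one antichain, and that elements of two non-homogeneous
blocks of `B` never share an antichain.

The types in `Ω_m` belong to chains of antichains whose initial segments contain, besides the
element `0`, first `K ≥ m_0` elements and then as many as each partial sum of `m` beyond `K`. Hence,
in a contraction of such a chain, every later non-homogeneous block fits between two consecutive
partial sums, no two of them between the same ones, and every later homogeneous block crosses a
partial sum. Conversely, if `B` satisfies the conditions, choose the least `K ≥ m_0` for which the
initial segment contains `B_{-1} ∪ B_0`, and cut an enumeration of `[0,n]` compatible with `B` at
`K` and at the partial sums beyond it: the resulting chain contracts to `B`.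
-/

namespace ParkingFan

open Finset

/-! ### Contractions of preorders -/

section Contraction

open Relation

variable {α : Type*} {r r' s : α → α → Prop} {x y : α}

/-- The preorder generated by `r` and those relations `r b a` whose reversal is allowed by `s`.
For preorders `r ≤ s` it lies between the two, and it equals `s` exactly when `s` is obtained
from `r` by contractions. -/
def reversalClosure (r s : α → α → Prop) : α → α → Prop :=
  ReflTransGen fun a b => r a b ∨ r b a ∧ s a b

theorem reversalClosure_mono_left (h : r ≤ r') : reversalClosure r s ≤ reversalClosure r' s :=
  ReflTransGen.mono fun a b hab => hab.imp (h a b) (And.imp_left (h b a))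

theorem reversalClosure_mono_right {s' : α → α → Prop} (h : s ≤ s') :
    reversalClosure r s ≤ reversalClosure r s' :=
  ReflTransGen.mono fun a b hab => hab.imp_right (And.imp_right (h a b))

theorem reversalClosure_le [IsPreorder α s] (h : r ≤ s) : reversalClosure r s ≤ s := by
  intro a b hab
  rw [← reflTransGen_eq_self (r := s)]
  exact ReflTransGen.mono (fun c d hcd => hcd.elim (h c d) And.right) a b hab

/-- Every step of a path from `x` to `y` lies in the class of `x` and `y` for `s`, so it can be
reversed. -/
theorem reversalClosure_symm [IsPreorder α s] (h : r ≤ s) (hxy : reversalClosure r s x y)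
    (hyx : s y x) : reversalClosure r s y x := by
  induction hxy using ReflTransGen.head_induction_on with
  | refl => exact .refl
  | @head a c hac hcy ih =>
    have hac' : s a c := reversalClosure_le h a c (.single hac)
    have hca : s c a := trans_of s (reversalClosure_le h c y hcy) hyx
    refine (ih (trans_of s hyx hac')).tail ?_
    rcases hac with hac | ⟨hca', -⟩
    · exact .inr ⟨hac, hca⟩
    · exact .inl hca'

instance isPreorder_contractEdge : IsPreorder α (contractEdge r x y) := by
  unfold contractEdge; infer_instance

theorem le_contractEdge : r ≤ contractEdge r x y := fun _ _ h => .single (.inl h)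

theorem contractEdge_apply : contractEdge r x y y x := .single (.inr ⟨rfl, rfl⟩)

theorem contractEdge_le [IsPreorder α s] (h : r ≤ s) (hyx : s y x) : contractEdge r x y ≤ s := by
  intro a b hab
  rw [← reflTransGen_eq_self (r := s)]
  refine ReflTransGen.mono ?_ a b hab
  rintro c d (hcd | ⟨rfl, rfl⟩)
  exacts [h c d hcd, hyx]

theorem IsContraction.le_and_le_reversalClosure [IsPreorder α r] (h : IsContraction s r) :
    IsPreorder α s ∧ r ≤ s ∧ s ≤ reversalClosure r s := by
  induction h with
  | refl => exact ⟨inferInstance, le_rfl, fun _ _ h => .single (.inl h)⟩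
  | @tail s t _ hst ih =>
    obtain ⟨x, y, hxy, rfl⟩ := hst
    obtain ⟨_, hrs, hsr⟩ := ih
    have hrt : r ≤ contractEdge s x y := hrs.trans le_contractEdge
    have hst : s ≤ reversalClosure r (contractEdge s x y) :=
      hsr.trans (reversalClosure_mono_right le_contractEdge)
    have : IsPreorder α (reversalClosure r (contractEdge s x y)) := by
      unfold reversalClosure; infer_instance
    exact ⟨inferInstance, hrt, contractEdge_le hst
      (reversalClosure_symm hrt (hst x y hxy.1.1) contractEdge_apply)⟩

theorem exists_covers [Finite α] [IsPreorder α r] (hxy : r x y) (hyx : ¬ r y x) :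
    ∃ z, r z y ∧ Covers r x z := by
  let _ : Preorder α :=
    { le := r, le_refl := refl_of r, le_trans := fun _ _ _ => trans_of r }
  obtain ⟨z, ⟨hzy, hxz⟩, hmin⟩ := (Set.toFinite {z | z ≤ y ∧ x < z}).exists_minimal
    ⟨y, le_rfl, lt_of_le_not_ge hxy hyx⟩
  exact ⟨z, hzy, lt_iff_le_not_ge.1 hxz, fun ⟨w, hxw, hwz⟩ =>
    hwz.2 (hmin ⟨trans_of r hwz.1 hzy, lt_iff_le_not_ge.2 hxw⟩ hwz.1)⟩

theorem isContraction_of_le_of_le_reversalClosure [Finite α] [hr : IsPreorder α r]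
    [IsPreorder α s] (hrs : r ≤ s) (hsr : s ≤ reversalClosure r s) : IsContraction s r := by
  induction r using WellFoundedGT.induction generalizing hr with
  | ind r ih =>
    by_cases h : ∃ x y, (r x y ∧ ¬ r y x) ∧ s y x
    · obtain ⟨x, y, ⟨hxy, hyx⟩, hs⟩ := h
      obtain ⟨z, hzy, hxz⟩ := exists_covers hxy hyx
      have hlt : r < contractEdge r x z :=
        lt_of_le_not_ge le_contractEdge fun hle => hxz.1.2 (hle z x contractEdge_apply)
      exact .head ⟨x, z, hxz, rfl⟩ (ih _ hlt (contractEdge_le hrs (trans_of s (hrs z y hzy) hs))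
        (hsr.trans (reversalClosure_mono_left le_contractEdge)))
    · push Not at h
      have hsr' : s ≤ r := fun a b hab => by
        rw [← reflTransGen_eq_self (r := r)]
        refine ReflTransGen.mono (fun c d hcd => hcd.elim id fun ⟨hdc, hs⟩ => ?_) a b (hsr a b hab)
        by_contra hcd
        exact h d c ⟨hdc, hcd⟩ hs
      rw [le_antisymm hsr' hrs]
      exact .refl

theorem isContraction_iff [Finite α] [IsPreorder α r] [IsPreorder α s] :
    IsContraction s r ↔ r ≤ s ∧ s ≤ reversalClosure r s :=
  ⟨fun h => h.le_and_le_reversalClosure.2,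
    fun h => isContraction_of_le_of_le_reversalClosure h.1 h.2⟩

end Contraction

section Layered

open Relation

variable {α ι κ : Type*}

/-- The preorder whose blocks are the fibres of `f`, in increasing order: the elements of a fibre
are equivalent if `H` holds for it, and pairwise incomparable otherwise. -/
def layeredRel [LT ι] (f : α → ι) (H : ι → Prop) (x y : α) : Prop :=
  x = y ∨ f x < f y ∨ (f x = f y ∧ H (f x))

instance isPreorder_layeredRel [Preorder ι] (f : α → ι) (H : ι → Prop) :
    IsPreorder α (layeredRel f H) where
  refl _ := .inl rfl
  trans := by
    rintro a b c (rfl | hab | ⟨hab, hH⟩) (rfl | hbc | ⟨hbc, hH'⟩)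
    · exact .inl rfl
    · exact .inr (.inl hbc)
    · exact .inr (.inr ⟨hbc, hH'⟩)
    · exact .inr (.inl hab)
    · exact .inr (.inl (hab.trans hbc))
    · exact .inr (.inl (hab.trans_eq hbc))
    · exact .inr (.inr ⟨hab, hH⟩)
    · exact .inr (.inl (hab.trans_lt hbc))
    · exact .inr (.inr ⟨hab.trans hbc, hH⟩)

theorem layeredRel.le [Preorder ι] {f : α → ι} {H : ι → Prop} {x y : α} (h : layeredRel f H x y) :
    f x ≤ f y := by
  rcases h with rfl | h | h
  exacts [le_rfl, h.le, h.1.le]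

theorem layeredRel.homog_of_symm [Preorder ι] {f : α → ι} {H : ι → Prop} {x y : α}
    (h : layeredRel f H x y) (h' : layeredRel f H y x) (hne : x ≠ y) : H (f x) :=
  ((h.resolve_left hne).resolve_left h'.le.not_gt).2

/-- The blocks of `g`, with `H` marking the homogeneous ones, arise by contractions from the chain
of antichains formed by the fibres of `f`. -/
structure IsCoarsening [LT ι] [LT κ] (f : α → ι) (g : α → κ) (H : κ → Prop) : Prop where
  le : ∀ ⦃x y⦄, f x < f y → g x < g y ∨ (g x = g y ∧ H (g x))
  spread : ∀ ⦃x⦄, H (g x) → ∃ y, g y = g x ∧ f y ≠ f x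
  homog : ∀ ⦃x y⦄, f x = f y → g x < g y → H (g x) ∨ H (g y)

variable {f : α → ι} {g : α → κ} {H : κ → Prop}

theorem reversalClosure_of_ne [LinearOrder ι] [LT κ] {x y : α} (hxy : layeredRel g H x y)
    (hne : f x ≠ f y) : reversalClosure (layeredRel f fun _ => False) (layeredRel g H) x y :=
  hne.lt_or_gt.elim (fun hlt => .single (.inl (.inr (.inl hlt))))
    fun hgt => .single (.inr ⟨.inr (.inl hgt), hxy⟩)

namespace IsCoarsening

theorem monotone [Preorder ι] [Preorder κ] (h : IsCoarsening f g H) {x y : α}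
    (hxy : f x < f y) : g x ≤ g y :=
  (h.le hxy).elim LT.lt.le fun h => h.1.le

theorem lt_of_not_homog [LinearOrder ι] [Preorder κ] (h : IsCoarsening f g H) {x y : α}
    (hxy : g x < g y) (hx : ¬ H (g x)) (hy : ¬ H (g y)) : f x < f y :=
  lt_of_not_ge fun hle => hle.eq_or_lt.elim
    (fun heq => (h.homog heq.symm hxy).elim hx hy) fun hlt => (h.monotone hlt).not_gt hxy

theorem layeredRel_le_reversalClosure [LinearOrder ι] [LT κ] (h : IsCoarsening f g H) :
    layeredRel g H ≤ reversalClosure (layeredRel f fun _ => False) (layeredRel g H) := by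
  intro x y hxy
  by_cases hne : f x = f y
  · have trans_of_ne {w : α} (hw : f w ≠ f x) (hxw : layeredRel g H x w)
        (hwy : layeredRel g H w y) :=
      (reversalClosure_of_ne hxw hw.symm).trans (reversalClosure_of_ne hwy (hne ▸ hw))
    rcases hxy with rfl | hlt | ⟨heq, hx⟩
    · exact .refl
    · rcases h.homog hne hlt with hx | hy
      · obtain ⟨w, hw, hfw⟩ := h.spread hx
        exact trans_of_ne hfw (.inr (.inr ⟨hw.symm, hx⟩)) (.inr (.inl (hw ▸ hlt)))
      · obtain ⟨w, hw, hfw⟩ := h.spread hy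
        exact trans_of_ne (hne ▸ hfw) (.inr (.inl (hw ▸ hlt))) (.inr (.inr ⟨hw, hw ▸ hy⟩))
    · obtain ⟨w, hw, hfw⟩ := h.spread hx
      exact trans_of_ne hfw (.inr (.inr ⟨hw.symm, hx⟩)) (.inr (.inr ⟨hw.trans heq, hw ▸ hx⟩))
  · exact reversalClosure_of_ne hxy hne

end IsCoarsening

theorem exists_ne_head {t : α → α → Prop} {x y : α} (h : ReflTransGen t x y) (hne : x ≠ y) :
    ∃ w ≠ x, t x w ∧ ReflTransGen t w y := by
  induction h using ReflTransGen.head_induction_on with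
  | refl => exact absurd rfl hne
  | @head a c hac hcy ih =>
    by_cases hca : c = a
    · subst hca
      exact ih hne
    · exact ⟨c, hca, hac, hcy⟩

theorem isCoarsening_of_reversalClosure [Preorder ι] [PartialOrder κ]
    (hH : ∀ x, H (g x) → ∃ y ≠ x, g y = g x)
    (hle : layeredRel f (fun _ => False) ≤ layeredRel g H)
    (hge : layeredRel g H ≤ reversalClosure (layeredRel f fun _ => False) (layeredRel g H)) :
    IsCoarsening f g H := by
  have lt_of_rel {x y : α} (hne : x ≠ y) (h : layeredRel f (fun _ => False) x y) : f x < f y :=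
    (h.resolve_left hne).resolve_right And.right
  have exists_step {x y : α} (hne : x ≠ y) (hxy : layeredRel g H x y) : ∃ w ≠ x,
      layeredRel g H x w ∧ layeredRel g H w y ∧ (f x < f w ∨ f w < f x) := by
    obtain ⟨w, hwx, hxw, hwy⟩ := exists_ne_head (hge x y hxy) hne
    exact ⟨w, hwx, reversalClosure_le hle x w (.single hxw), reversalClosure_le hle w y hwy,
      hxw.imp (lt_of_rel hwx.symm) fun h => lt_of_rel hwx h.1⟩
  refine ⟨fun x y hxy => ?_, fun x hx => ?_, fun x y hxy hlt => ?_⟩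
  · exact (hle x y (.inr (.inl hxy))).resolve_left (by rintro rfl; exact hxy.false)
  · obtain ⟨y, hne, hy⟩ := hH x hx
    obtain ⟨w, -, hxw, hwy, hf⟩ := exists_step hne.symm (.inr (.inr ⟨hy.symm, hx⟩))
    exact ⟨w, le_antisymm (hwy.le.trans_eq hy) hxw.le, hf.elim ne_of_gt ne_of_lt⟩
  · obtain ⟨w, hwx, hxw, hwy, hf⟩ := exists_step (ne_of_apply_ne g hlt.ne) (.inr (.inl hlt))
    rcases hf with hf | hf
    · have hyw : f y < f w := hxy ▸ hf
      exact .inr ((hle y w (.inr (.inl hyw))).homog_of_symm hwy (ne_of_apply_ne f hyw.ne))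
    · exact .inl (hxw.homog_of_symm (hle w x (.inr (.inl hf))) hwx.symm)

theorem isContraction_layeredRel_iff [Finite α] [LinearOrder ι] [PartialOrder κ]
    (hH : ∀ x, H (g x) → ∃ y ≠ x, g y = g x) :
    IsContraction (layeredRel g H) (layeredRel f fun _ => False) ↔ IsCoarsening f g H := by
  rw [isContraction_iff]
  refine ⟨fun h => isCoarsening_of_reversalClosure hH h.1 h.2,
    fun h => ⟨?_, h.layeredRel_le_reversalClosure⟩⟩
  rintro x y (rfl | hlt | ⟨-, ⟨⟩⟩)
  exacts [.inl rfl, .inr (h.le hlt)]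

end Layered

/-! ### Partial sums of multiplicity vectors -/

section PartialSums

variable {N : ℕ} (f : Fin N → ℕ)

theorem segSum_zero_left (k : ℕ) : segSum f 0 k = ((List.ofFn f).take k).sum := by
  simp only [segSum, zero_le, true_and, List.sum_take_ofFn]

theorem segSum_zero_succ {k : ℕ} (hk : k < N) :
    segSum f 0 (k + 1) = segSum f 0 k + f ⟨k, hk⟩ := by
  rw [segSum_zero_left, segSum_zero_left, List.sum_take_succ _ _ (by simpa using hk),
    List.getElem_ofFn]

theorem segSum_zero_mono : Monotone (segSum f 0) := fun _ _ hab =>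
  sum_le_sum_of_subset (monotone_filter_right _ fun _ _ h => ⟨h.1, h.2.trans_le hab⟩)

theorem segSum_zero_of_le {k : ℕ} (hk : N ≤ k) : segSum f 0 k = ∑ t, f t := by
  rw [segSum, filter_true_of_mem fun t _ => ⟨zero_le, t.2.trans_le hk⟩]

theorem segSum_zero_one (f : Fin (N + 1) → ℕ) : segSum f 0 1 = f 0 := by
  simp [segSum_zero_left]

theorem segSum_zero_eq_add (f : Fin (N + 1) → ℕ) {k : ℕ} (hk : 1 ≤ k) :
    segSum f 0 k = f 0 + segSum f 1 k := by
  have h : ({t | 0 ≤ t.val ∧ t.val < k} : Finset (Fin (N + 1))) =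
      insert 0 ({t | 1 ≤ t.val ∧ t.val < k} : Finset (Fin (N + 1))) := by
    ext t
    simp only [mem_filter_univ, mem_insert, Fin.ext_iff, Fin.val_zero]
    omega
  rw [segSum, h, sum_insert (by simp), segSum]

theorem Fits.unique_left {ℓ p : ℕ} {m : Fin (ℓ + 1) → ℕ} {b : Fin (p + 2) → Entry} {i i' j : ℕ}
    (h : Fits m b i j) (h' : Fits m b i' j) : i = i' := by
  obtain ⟨-, -, hl, hlt, hr⟩ := h
  obtain ⟨-, -, hl', -, hr'⟩ := h'
  have hi : i < i' + 1 := (segSum_zero_mono m).reflect_lt (by omega)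
  have hi' : i' < i + 1 := (segSum_zero_mono m).reflect_lt (by omega)
  omega

end PartialSums

namespace IsMultiplicityVector

variable {n ℓ : ℕ} {m : Fin (ℓ + 1) → ℕ}

theorem sum_eq (hm : IsMultiplicityVector n m) : ∑ t, m t = n := by
  obtain ⟨u, d, -, hu, -, hd, hr, h0, hsucc⟩ := hm
  have hpos (i) : 0 < d i := ((hr (d i)).1 ⟨i, rfl⟩).1
  let v : Fin (ℓ + 1) → ℝ := Fin.cons 0 d
  have hv : Function.Injective v :=
    Fin.cons_injective_iff.2 ⟨fun ⟨i, hi⟩ => (hpos i).ne' hi, hd.injective⟩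
  have hex (j) : ∃ t, v t = u j := by
    rcases (hu j).eq_or_lt with hj | hj
    · exact ⟨0, hj⟩
    · obtain ⟨i, hi⟩ := (hr (u j)).2 ⟨hj, j, rfl⟩
      exact ⟨i.succ, hi⟩
  choose c hc using hex
  have hcard (t) : m t = #{j | c j = t} := by
    have hm : m t = Nat.card {j // u j = v t} := Fin.cases h0 hsucc t
    rw [hm, Nat.subtype_card]
    simp [← hc, hv.eq_iff]
  simp only [hcard, sum_card_fiberwise_eq_card_filter, mem_univ, filter_true, card_fin]

theorem pos (hm : IsMultiplicityVector n m) (i : Fin ℓ) : 0 < m i.succ := by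
  obtain ⟨u, d, -, -, -, -, hr, -, hsucc⟩ := hm
  obtain ⟨j, hj⟩ := ((hr (d i)).1 ⟨i, rfl⟩).2
  rw [hsucc]
  have : Nonempty {j // u j = d i} := ⟨⟨j, hj⟩⟩
  exact Nat.card_pos

theorem one_le (hm : IsMultiplicityVector n m) : 1 ≤ ℓ := by
  obtain ⟨u, d, -, hu, hne, -, hr, -⟩ := hm
  obtain ⟨j, hj⟩ := Function.ne_iff.1 hne
  obtain ⟨i, -⟩ := (hr (u j)).2 ⟨(hu j).lt_of_ne' hj, j, rfl⟩
  exact i.pos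

theorem segSum_eq (hm : IsMultiplicityVector n m) {k : ℕ} (hk : ℓ + 1 ≤ k) :
    segSum m 0 k = n := by
  rw [segSum_zero_of_le m hk, hm.sum_eq]

theorem segSum_le (hm : IsMultiplicityVector n m) (k : ℕ) : segSum m 0 k ≤ n := by
  rw [← hm.segSum_eq (le_max_left (ℓ + 1) k)]
  exact segSum_zero_mono m (le_max_right _ _)

theorem segSum_lt_succ (hm : IsMultiplicityVector n m) {i : ℕ} (hi : 1 ≤ i) (hi' : i ≤ ℓ) :
    segSum m 0 i < segSum m 0 (i + 1) := by
  obtain ⟨i, rfl⟩ := Nat.exists_eq_add_of_le' hi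
  rw [segSum_zero_succ m (k := i + 1) (by omega)]
  exact Nat.lt_add_of_pos_right (hm.pos ⟨i, hi'⟩)

theorem apply_zero_lt (hm : IsMultiplicityVector n m) : m 0 < n := by
  rw [← segSum_zero_one m]
  exact (hm.segSum_lt_succ le_rfl hm.one_le).trans_le (hm.segSum_le 2)

end IsMultiplicityVector

section CountLT

variable {α : Type*} [Fintype α] {f g : α → ℕ} {a b : ℕ}

/-- The number of elements in the blocks at positions `0, …, k - 1`, for the partition of `α` into
the fibres of `f`. -/
def countLT (f : α → ℕ) (k : ℕ) : ℕ := #{z | f z < k}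

theorem countLT_le_countLT (h : ∀ z, f z < a → g z < b) : countLT f a ≤ countLT g b :=
  card_le_card (monotone_filter_right _ fun z _ => h z)

theorem countLT_lt_countLT (h : ∀ z, f z < a → g z < b) {w : α} (hw : g w < b) (hw' : a ≤ f w) :
    countLT f a < countLT g b :=
  card_lt_card (ssubset_iff_of_subset (monotone_filter_right _ fun z _ => h z) |>.2
    ⟨w, by simpa using hw, by simpa using hw'⟩)

theorem countLT_mono (f : α → ℕ) : Monotone (countLT f) := fun _ _ hab =>
  countLT_le_countLT fun _ hz => hz.trans_le hab

end CountLT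

/-! ### The compositions in `Ω_m` -/

section Omega

variable {n ℓ K g : ℕ} {m : Fin (ℓ + 1) → ℕ} {L : List ℕ}

/-- `K ∈ [m_0, n]` lies between the partial sums `m_0 + ⋯ + m_{g-1}` (inclusive) and
`m_0 + ⋯ + m_g` (exclusive); `K = n` corresponds to `g = ℓ + 1`. -/
structure IsCut (m : Fin (ℓ + 1) → ℕ) (K g : ℕ) : Prop where
  one_le : 1 ≤ g
  le_succ : g ≤ ℓ + 1
  segSum_le : segSum m 0 g ≤ K
  lt_segSum : g ≤ ℓ → K < segSum m 0 (g + 1)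
  le_segSum : K ≤ segSum m 0 (ℓ + 1)

/-- `L` lists the increments of the sequence of `K` and the partial sums of `m` that follow the
`g`-th one. -/
structure IsRemainder (m : Fin (ℓ + 1) → ℕ) (K g : ℕ) (L : List ℕ) : Prop where
  length_add : L.length + g = ℓ + 1
  add_sum_take : ∀ k, K + (L.take k).sum = max (segSum m 0 (g + k)) K

theorem segSum_add_sum_take_drop (m : Fin (ℓ + 1) → ℕ) (g k : ℕ) :
    segSum m 0 g + (((List.ofFn m).drop g).take k).sum = segSum m 0 (g + k) := by
  rw [segSum_zero_left, segSum_zero_left, List.take_add, List.sum_append]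

theorem IsRemainder.unique {L' : List ℕ} (h : IsRemainder m K g L) (h' : IsRemainder m K g L') :
    L = L' := by
  refine List.eq_of_sum_take_eq (Nat.add_right_cancel (h.length_add.trans h'.length_add.symm))
    fun k _ => Nat.add_left_cancel (n := K) ?_
  rw [h.add_sum_take, h'.add_sum_take]

theorem isRemainder_drop_one (m : Fin (ℓ + 1) → ℕ) :
    IsRemainder m (m 0) 1 ((List.ofFn m).drop 1) where
  length_add := by simp
  add_sum_take k := by
    have h := segSum_add_sum_take_drop m 1 k
    rw [segSum_zero_one] at h
    omega

theorem isRemainder_cons_drop (hg : g ≤ ℓ) (h : segSum m 0 g ≤ K) (h' : K ≤ segSum m 0 (g + 1)) :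
    IsRemainder m K g ((segSum m 0 (g + 1) - K) :: (List.ofFn m).drop (g + 1)) where
  length_add := by
    simp only [List.length_cons, List.length_drop, List.length_ofFn]
    omega
  add_sum_take
    | 0 => by simp [h]
    | k + 1 => by
      have hsum := segSum_add_sum_take_drop m (g + 1) k
      rw [add_right_comm, add_assoc] at hsum
      rw [List.take_succ_cons, List.sum_cons]
      omega

theorem isRemainder_nil (h : segSum m 0 (ℓ + 1) ≤ K) : IsRemainder m K (ℓ + 1) [] where
  length_add := by simp
  add_sum_take k := by
    rw [segSum_zero_of_le m le_rfl] at h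
    rw [segSum_zero_of_le m (Nat.le_add_right _ k), List.take_nil, List.sum_nil, max_eq_right h,
      add_zero]

theorem isCut_apply_zero (hm : IsMultiplicityVector n m) : IsCut m (m 0) 1 where
  one_le := le_rfl
  le_succ := by omega
  segSum_le := (segSum_zero_one m).le
  lt_segSum h := segSum_zero_one m ▸ hm.segSum_lt_succ le_rfl h
  le_segSum := segSum_zero_one m ▸ segSum_zero_mono m (by omega)

theorem IsCut.apply_zero_le (h : IsCut m K g) : m 0 ≤ K :=
  segSum_zero_one m ▸ (segSum_zero_mono m h.one_le).trans h.segSum_le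

theorem IsCut.le_segSum_add_succ (h : IsCut m K g) (k : ℕ) : K ≤ segSum m 0 (g + (k + 1)) := by
  obtain hg | rfl := Nat.le_succ_iff.1 h.le_succ
  · exact (h.lt_segSum hg).le.trans (segSum_zero_mono m (by omega))
  · exact h.le_segSum.trans (segSum_zero_mono m (by omega))

theorem IsCut.eq_one (h : IsCut m (m 0) g) (hm : IsMultiplicityVector n m) : g = 1 := by
  by_contra hne
  have h2 : 2 ≤ g := by have := h.one_le; omega
  have hlt := hm.segSum_lt_succ le_rfl hm.one_le
  rw [segSum_zero_one] at hlt
  exact (hlt.trans_le (segSum_zero_mono m h2)).not_ge h.segSum_le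

theorem cons_circ_cons_mem_Omega (hcut : IsCut m K g) (hL : IsRemainder m K g L) (hK : m 0 < K) :
    .plain K :: .circ 0 :: L.map .plain ∈ Omega m := by
  have hle := hcut.segSum_le
  obtain hg | rfl := Nat.le_succ_iff.1 hcut.le_succ
  · have hS := segSum_zero_eq_add m hcut.one_le
    have hS' := segSum_zero_eq_add m (k := g + 1) (by omega)
    have hlt := hcut.lt_segSum hg
    rw [hL.unique (isRemainder_cons_drop hg hle hlt.le)]
    refine .inr (.inr (.inl ⟨K - m 0, g, by omega, hcut.one_le, hg, by omega, by omega, ?_⟩))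
    rw [Nat.add_sub_cancel' hK.le, List.map_cons]
    congr 4
    omega
  · have hKn : K = ∑ t, m t := by
      rw [← segSum_zero_of_le m le_rfl]
      exact le_antisymm hcut.le_segSum hle
    rw [hL.unique (isRemainder_nil hle), hKn]
    exact .inr (.inr (.inr rfl))

theorem mem_Omega_iff (hm : IsMultiplicityVector n m) {a : List Entry} :
    a ∈ Omega m ↔ ∃ K g e L, a = .plain K :: e :: L.map .plain ∧ IsCut m K g ∧
      IsRemainder m K g L ∧
      (K = m 0 ∧ (0 < m 0 ∧ e = .plain 0 ∨ m 0 = 0 ∧ e = .circ 0) ∨ m 0 < K ∧ e = .circ 0) := by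
  constructor
  · rintro (⟨h0, rfl⟩ | ⟨h0, rfl⟩ | ⟨i, g, hi, hg, hgℓ, hgi, hig, rfl⟩ | rfl)
    · exact ⟨m 0, 1, .plain 0, _, rfl, isCut_apply_zero hm, isRemainder_drop_one m,
        .inl ⟨rfl, .inl ⟨h0, rfl⟩⟩⟩
    · exact ⟨m 0, 1, .circ 0, _, by rw [h0], isCut_apply_zero hm, isRemainder_drop_one m,
        .inl ⟨rfl, .inr ⟨h0, rfl⟩⟩⟩
    · have hS := segSum_zero_eq_add m hg
      have hS' := segSum_zero_eq_add m (k := g + 1) (by omega)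
      have hmono := segSum_zero_mono m (show g + 1 ≤ ℓ + 1 by omega)
      have hsub : segSum m 1 (g + 1) - i = segSum m 0 (g + 1) - (m 0 + i) := by omega
      exact ⟨m 0 + i, g, .circ 0, _, by rw [hsub, List.map_cons],
        ⟨hg, by omega, by omega, fun _ => by omega, by omega⟩,
        isRemainder_cons_drop hgℓ (by omega) (by omega), .inr ⟨by omega, rfl⟩⟩
    · have hS := segSum_zero_of_le m (le_refl (ℓ + 1))
      exact ⟨∑ t, m t, ℓ + 1, .circ 0, [], rfl, ⟨by omega, le_rfl, hS.le, by omega, hS.ge⟩,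
        isRemainder_nil hS.le, .inr ⟨hm.sum_eq ▸ hm.apply_zero_lt, rfl⟩⟩
  · rintro ⟨K, g, e, L, rfl, hcut, hL, ⟨rfl, he⟩ | ⟨hK, rfl⟩⟩
    · obtain rfl := hcut.eq_one hm
      rw [hL.unique (isRemainder_drop_one m)]
      rcases he with ⟨h0, rfl⟩ | ⟨h0, rfl⟩
      · exact .inl ⟨h0, rfl⟩
      · exact .inr (.inl ⟨h0, by rw [h0]⟩)
    · exact cons_circ_cons_mem_Omega hcut hL hK

end Omega

section Levels

variable {N n ℓ K g : ℕ} {m : Fin (ℓ + 1) → ℕ}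

theorem exists_perm_lt_countLT_iff (b : Fin N → ℕ) :
    ∃ pos : Equiv.Perm (Fin N), ∀ z c, (pos z : ℕ) < countLT b c ↔ b z < c := by
  refine ⟨(Tuple.sort b).symm, fun z c => ?_⟩
  have h := Tuple.lt_card_lt_iff_apply_lt_of_monotone (j := (Tuple.sort b).symm z) (a := c)
    (Tuple.monotone_sort b)
  have hcard : #{i | (b ∘ Tuple.sort b) i < c} = countLT b c :=
    card_equiv (Tuple.sort b) fun i => by simp
  rwa [hcard, Function.comp_apply, Equiv.apply_symm_apply] at h

theorem exists_levels (b : Fin (n + 1) → ℕ) {T : ℕ → ℕ} (hT : Monotone T) (hn : ∃ k, n ≤ T k) :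
    ∃ L : Fin (n + 1) → ℕ, (∀ k, T k ≤ n → countLT L (k + 1) = T k + 1) ∧
      ∀ x y, L x < L y → b x ≤ b y := by
  obtain ⟨pos, hpos⟩ := exists_perm_lt_countLT_iff b
  have hex (z) : ∃ k, (pos z : ℕ) ≤ T k := hn.imp fun k hk => (pos z).is_le.trans hk
  have hL (z k) : Nat.find (hex z) ≤ k ↔ (pos z : ℕ) ≤ T k :=
    (Nat.find_le_iff _ _).trans ⟨fun ⟨_, hj, hz⟩ => hz.trans (hT hj), fun hz => ⟨k, le_rfl, hz⟩⟩
  refine ⟨fun z => Nat.find (hex z), fun k hk => ?_, fun x y hxy => ?_⟩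
  · simp only [countLT, Nat.lt_succ_iff, hL]
    rw [card_equiv (t := {i : Fin (n + 1) | i.val < T k + 1}) pos fun i => by
      simp, Fin.card_filter_val_lt, min_eq_right (by omega)]
  · have hlt : (pos x : ℕ) < pos y := by
      by_contra! hle
      exact hxy.not_ge ((hL y _).2 (hle.trans ((hL x _).1 le_rfl)))
    exact Nat.lt_succ_iff.1 ((hpos x _).1 (hlt.trans ((hpos y _).2 (Nat.lt_succ_self _))))

theorem exists_isCut (hm : IsMultiplicityVector n m) (hK : m 0 ≤ K) (hKn : K ≤ n) :
    ∃ g, IsCut m K g := by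
  set g := Nat.findGreatest (fun i => segSum m 0 i ≤ K) (ℓ + 1) with hg
  have h1 : segSum m 0 1 ≤ K := (segSum_zero_one m).trans_le hK
  exact ⟨g, Nat.le_findGreatest (by omega) h1, Nat.findGreatest_le _,
    Nat.findGreatest_spec (P := fun i => segSum m 0 i ≤ K) (by omega) h1,
    fun hlt => not_le.1 (Nat.findGreatest_is_greatest (P := fun i => segSum m 0 i ≤ K)
      (hg ▸ Nat.lt_succ_self g) (by omega)),
    (hm.segSum_eq le_rfl).symm ▸ hKn⟩

theorem level_add_le (hm : IsMultiplicityVector n m) (hcut : IsCut m K g) {L : Fin (n + 1) → ℕ}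
    (hL : ∀ k, countLT L (k + 1) = max (segSum m 0 (g + k)) K + 1) (z : Fin (n + 1)) :
    L z + g ≤ ℓ + 1 := by
  by_contra! hz
  have hlt : countLT L (ℓ + 1 - g + 1) < countLT (fun _ : Fin (n + 1) => 0) 1 :=
    countLT_lt_countLT (fun _ _ => one_pos) one_pos (w := z)
      (by have := hcut.le_succ; omega)
  rw [hL, Nat.add_sub_cancel' hcut.le_succ, hm.segSum_eq le_rfl] at hlt
  have hcard : countLT (fun _ : Fin (n + 1) => 0) 1 = n + 1 := by simp [countLT]
  omega

theorem exists_level_eq (hm : IsMultiplicityVector n m) (hcut : IsCut m K g) {L : Fin (n + 1) → ℕ}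
    (hL : ∀ k, countLT L (k + 1) = max (segSum m 0 (g + k)) K + 1) {k : ℕ} (hk : g + k ≤ ℓ) :
    ∃ z, L z = k + 1 := by
  by_contra! hne
  have hg := hcut.one_le
  have hcount : countLT L (k + 1 + 1) ≤ countLT L (k + 1) :=
    countLT_le_countLT fun z hz => (Nat.le_of_lt_succ hz).lt_of_ne (hne z)
  have hlt := hm.segSum_lt_succ (i := g + k) (by omega) hk
  have hK := (hcut.lt_segSum (by omega)).trans_le
    (segSum_zero_mono m (show g + 1 ≤ g + (k + 1) by omega))
  rw [hL, hL, max_eq_left hK.le, Nat.add_le_add_iff_right] at hcount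
  exact hcount.not_gt (max_lt hlt hK)

end Levels

/-! ### Blocks and types of skewed binary partitions -/

namespace SkewedBinaryPartition

variable {n : ℕ} (B : SkewedBinaryPartition n)

/-- The position of the block containing `x`: `k + 1` if `x ∈ B_k`. -/
noncomputable def idx (x : Fin (n + 1)) : ℕ := (B.cover x).choose

/-- The block at position `k`, that is `B_{k-1}`, is homogeneous. -/
def HomogAt (k : ℕ) : Prop := ∃ h : k < B.p + 2, B.homog ⟨k, h⟩ = true

variable {B} {x y : Fin (n + 1)}

theorem idx_lt (x : Fin (n + 1)) : B.idx x < B.p + 2 := (B.cover x).choose.isLt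

theorem mem_block_iff {i : Fin (B.p + 2)} : x ∈ B.block i ↔ B.idx x = i := by
  have hx : x ∈ B.block (B.cover x).choose := (B.cover x).choose_spec
  refine ⟨fun h => ?_, fun h => Fin.ext h ▸ hx⟩
  by_contra hne
  exact disjoint_left.1 (B.disjoint _ i fun h => hne (congrArg Fin.val h)) hx h

theorem block_eq_filter (i : Fin (B.p + 2)) : B.block i = ({z | B.idx z = i} : Finset _) := by
  ext z
  simp only [mem_block_iff, mem_filter_univ]

theorem homogAt_val {i : Fin (B.p + 2)} : B.HomogAt i ↔ B.homog i = true :=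
  exists_prop_of_true i.isLt

theorem rel_eq_layeredRel : B.rel = layeredRel B.idx B.HomogAt := by
  ext x y
  refine or_congr_right (or_congr ⟨?_, fun h => ?_⟩ ⟨?_, ?_⟩)
  · rintro ⟨i, j, hij, hx, hy⟩
    rwa [mem_block_iff.1 hx, mem_block_iff.1 hy]
  · exact ⟨⟨_, idx_lt x⟩, ⟨_, idx_lt y⟩, h, mem_block_iff.2 rfl, mem_block_iff.2 rfl⟩
  · rintro ⟨i, hi, hx, hy⟩
    rw [mem_block_iff.1 hx, mem_block_iff.1 hy]
    exact ⟨rfl, homogAt_val.2 hi⟩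
  · rintro ⟨hxy, hlt, hhom⟩
    exact ⟨⟨_, hlt⟩, hhom, mem_block_iff.2 rfl, mem_block_iff.2 hxy.symm⟩

theorem idx_zero_le_one : B.idx 0 ≤ 1 := by
  rcases B.zero_mem with h | h <;> simp [mem_block_iff.1 h]

theorem zero_mem_block_one : 0 ∈ B.block 1 ↔ B.idx 0 = 1 := by
  rw [mem_block_iff, Fin.val_one]

theorem idx_ne_one (h : B.idx 0 = 0) (z : Fin (n + 1)) : B.idx z ≠ 1 := by
  have h1 : B.block 1 = ∅ := (B.zero_mem_first (mem_block_iff.2 (by simpa using h))).2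
  intro hz
  have : z ∈ B.block 1 := mem_block_iff.2 (by simpa using hz)
  simp [h1] at this

theorem idx_zero_eq_one (h : B.idx x = 1) : B.idx 0 = 1 :=
  (Nat.le_one_iff_eq_zero_or_eq_one.1 idx_zero_le_one).resolve_left fun h0 => idx_ne_one h0 x h

theorem not_homogAt_zero : ¬ B.HomogAt 0 := by
  rintro ⟨_, h⟩
  simp [B.first_nonhomog] at h

theorem one_lt_card_block {i : Fin (B.p + 2)} (h : B.HomogAt i) : 1 < #(B.block i) := by
  by_contra hle
  simp [homogAt_val, B.small_nonhomog i (not_lt.1 hle)] at h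

theorem exists_ne_of_homogAt (h : B.HomogAt (B.idx x)) : ∃ y ≠ x, B.idx y = B.idx x := by
  obtain ⟨y, hy, hne⟩ := exists_mem_ne (one_lt_card_block (i := ⟨_, idx_lt x⟩) h) x
  exact ⟨y, hne, mem_block_iff.1 hy⟩

theorem homogAt_one (hx : B.idx x = 1) (hy : B.idx y = 1) (hne : x ≠ y) : B.HomogAt 1 := by
  have hcard : 1 < #(B.block 1) := one_lt_card.2
    ⟨x, mem_block_iff.2 (by simpa using hx), y, mem_block_iff.2 (by simpa using hy), hne⟩
  exact homogAt_val (i := 1).2 (B.second_homog hcard)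

theorem exists_idx_eq {k : ℕ} (hk : 2 ≤ k) (hk' : k < B.p + 2) : ∃ x, B.idx x = k := by
  obtain ⟨x, hx⟩ := B.nonempty ⟨k, hk'⟩ hk
  exact ⟨x, mem_block_iff.1 hx⟩

theorem isContraction_rel_iff {A : SkewedBinaryPartition n} (hA : ∀ k, ¬ A.HomogAt k) :
    IsContraction B.rel A.rel ↔ IsCoarsening A.idx B.idx B.HomogAt := by
  have hA' : A.HomogAt = fun _ => False := funext fun k => eq_false (hA k)
  rw [rel_eq_layeredRel, rel_eq_layeredRel, hA',
    isContraction_layeredRel_iff fun x => exists_ne_of_homogAt]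

theorem type_zero : B.type 0 = .plain (#(B.block 0) - if B.idx 0 = 0 then 1 else 0) := by
  have := idx_zero_le_one (B := B)
  simp only [type, if_true, zero_mem_block_one]
  split_ifs <;> first | rfl | omega

theorem type_one : B.type 1 =
    if B.idx 0 = 1 then .circ (#(B.block 1) - 1) else .plain #(B.block 1) := by
  simp [type, zero_mem_block_one]

theorem type_of_two_le {i : Fin (B.p + 2)} (hi : 2 ≤ i.val) :
    B.type i = if B.homog i = true then .star #(B.block i) else .plain #(B.block i) := by
  have h0 : i ≠ 0 := by rintro rfl; simp at hi
  have h1 : i ≠ 1 := by rintro rfl; simp at hi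
  rw [type, if_neg h0, if_neg h1]

theorem card_block (i : Fin (B.p + 2)) :
    #(B.block i) = (B.type i).abs + if B.idx 0 = i then 1 else 0 := by
  have h01 := idx_zero_le_one (B := B)
  have hpos (h : B.idx 0 = i) : 1 ≤ #(B.block i) := card_pos.2 ⟨0, mem_block_iff.2 h⟩
  obtain rfl | rfl | hi : i = 0 ∨ i = 1 ∨ 2 ≤ i.val := by
    simp only [Fin.ext_iff, Fin.val_zero, Fin.val_one]; omega
  · rw [type_zero]
    split_ifs with h0 h0' <;> simp_all [Entry.abs]
  · rw [type_one]
    split_ifs with h1 h1' <;> simp_all [Entry.abs]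
  · rw [type_of_two_le hi, if_neg (c := B.idx 0 = i) (by omega)]
    split_ifs <;> rfl

theorem countLT_idx {k : ℕ} (hk : 2 ≤ k) :
    countLT B.idx k = segSum (fun t => (B.type t).abs) 0 k + 1 := by
  let block₀ : Fin (B.p + 2) := ⟨B.idx 0, idx_lt 0⟩
  calc countLT B.idx k = ∑ t : Fin (B.p + 2) with t.val < k, #(B.block t) := by
        rw [countLT, card_eq_sum_card_fiberwise (f := fun z => (⟨B.idx z, idx_lt z⟩ : Fin _))
          (t := ({t | t.val < k} : Finset (Fin (B.p + 2)))) fun z hz => by simpa using hz]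
        refine sum_congr rfl fun t ht => ?_
        rw [block_eq_filter, filter_filter]
        congr 1
        ext z
        simp only [mem_filter_univ, Fin.ext_iff] at ht ⊢
        omega
    _ = ∑ t : Fin (B.p + 2) with t.val < k, ((B.type t).abs + if t = block₀ then 1 else 0) := by
        simp only [card_block, block₀, Fin.ext_iff, eq_comm]
    _ = segSum (fun t => (B.type t).abs) 0 k + 1 := by
        have h0 : B.idx 0 < k := by have := idx_zero_le_one (B := B); omega
        simp [sum_add_distrib, segSum, block₀, h0]

theorem countLT_idx_two : countLT B.idx 2 = (B.type 0).abs + (B.type 1).abs + 1 := by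
  rw [countLT_idx le_rfl, segSum_zero_succ _ (by omega), segSum_zero_one]
  rfl

theorem countLT_idx_of_le {k : ℕ} (hk : B.p + 2 ≤ k) : countLT B.idx k = n + 1 := by
  rw [countLT, filter_true_of_mem fun z _ => (idx_lt z).trans_le hk, card_univ, Fintype.card_fin]

theorem type_one_eq_plain_zero_iff : B.type 1 = .plain 0 ↔ B.idx 0 = 0 := by
  have h01 := idx_zero_le_one (B := B)
  rw [type_one]
  split_ifs with h
  · simp [h]
  · have h0 : B.idx 0 = 0 := by omega
    simpa [h0, block_eq_filter, filter_eq_empty_iff] using idx_ne_one h0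

theorem isPos_type_iff (j : Fin B.p) : (B.type j.succ.succ).IsPos ↔ ¬ B.HomogAt (j + 2) := by
  have hpos : 0 < #(B.block j.succ.succ) := card_pos.2 (B.nonempty _ (by simp))
  have hhom : B.HomogAt (j + 2) ↔ B.homog j.succ.succ = true := homogAt_val (i := j.succ.succ)
  rw [type_of_two_le (by simp), hhom]
  split_ifs with h <;> simp [Entry.IsPos, h, hpos]

theorem isPosStar_type_iff (j : Fin B.p) : (B.type j.succ.succ).IsPosStar ↔ B.HomogAt (j + 2) := by
  have hpos : 0 < #(B.block j.succ.succ) := card_pos.2 (B.nonempty _ (by simp))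
  have hhom : B.HomogAt (j + 2) ↔ B.homog j.succ.succ = true := homogAt_val (i := j.succ.succ)
  rw [type_of_two_le (by simp), hhom]
  split_ifs with h <;> simp [Entry.IsPosStar, h, hpos]

theorem isSkewedBinaryComposition_type : IsSkewedBinaryComposition n B.type := by
  refine ⟨?_, ?_, fun i hi => ?_⟩
  · have h1 := countLT_idx (B := B) (k := B.p + 2) (by omega)
    rw [segSum_zero_of_le _ le_rfl, countLT_idx_of_le le_rfl] at h1
    omega
  · obtain h0 | h1 := Nat.le_one_iff_eq_zero_or_eq_one.1 (idx_zero_le_one (B := B))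
    · have hcard := (B.zero_mem_first (mem_block_iff.2 (by simpa using h0))).1
      exact .inr ⟨_, by rw [if_pos h0]; omega, type_zero, type_one_eq_plain_zero_iff.2 h0⟩
    · exact .inl ⟨_, _, type_zero, by rw [type_one, if_pos h1]⟩
  · rw [type_of_two_le hi]
    split_ifs with h
    · exact .inr ⟨_, one_lt_card_block (homogAt_val.2 h), rfl⟩
    · exact .inl ⟨_, card_pos.2 (B.nonempty i hi), rfl⟩

theorem countLT_idx_lt_succ (x : Fin (n + 1)) :
    countLT B.idx (B.idx x) < countLT B.idx (B.idx x + 1) :=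
  countLT_lt_countLT (fun _ hz => hz.trans (Nat.lt_succ_self _)) (Nat.lt_succ_self _) le_rfl

theorem fits_idx_sub_one_iff {ℓ : ℕ} {m : Fin (ℓ + 1) → ℕ} {i : ℕ} (hx : 2 ≤ B.idx x) :
    Fits m B.type i (B.idx x - 1) ↔ (1 ≤ i ∧ i ≤ ℓ) ∧ segSum m 0 i < countLT B.idx (B.idx x) ∧
      countLT B.idx (B.idx x + 1) ≤ segSum m 0 (i + 1) + 1 := by
  have hxp := idx_lt (B := B) x
  have hlt := countLT_idx_lt_succ (B := B) x
  rw [countLT_idx hx, countLT_idx (k := B.idx x + 1) (by omega)] at hlt ⊢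
  rw [Fits, Nat.sub_add_cancel (by omega), show B.idx x - 1 + 2 = B.idx x + 1 by omega]
  omega

/-! ### Partitions with type in `Ω_m` -/

variable {ℓ K g : ℕ} {m : Fin (ℓ + 1) → ℕ} {A : SkewedBinaryPartition n}

theorem ofFn_type (A : SkewedBinaryPartition n) :
    List.ofFn A.type = A.type 0 :: A.type 1 :: List.ofFn fun j : Fin A.p => A.type j.succ.succ := by
  rw [List.ofFn_succ, List.ofFn_succ, Fin.succ_zero_eq_one]

theorem ofFn_type_of_forall_not_homogAt (h : ∀ k, ¬ A.HomogAt k) :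
    List.ofFn A.type =
      A.type 0 :: A.type 1 :: (List.ofFn fun j : Fin A.p => #(A.block j.succ.succ)).map .plain := by
  rw [ofFn_type, List.map_ofFn]
  congr
  funext j
  rw [type_of_two_le (by simp), if_neg fun hj => h _ (homogAt_val.2 hj), Function.comp]

theorem not_homogAt_of_ofFn_type {a b : Entry} {L : List ℕ}
    (h : List.ofFn A.type = a :: b :: L.map .plain) (hb : b.abs = 0) (k : ℕ) :
    ¬ A.HomogAt k := by
  rw [ofFn_type, List.cons.injEq, List.cons.injEq] at h
  rintro ⟨hk, hhom⟩
  have hcard := one_lt_card_block (homogAt_val.2 hhom)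
  match k with
  | 0 => exact not_homogAt_zero ⟨hk, hhom⟩
  | 1 =>
    change 1 < #(A.block 1) at hcard
    rw [card_block, h.2.1, hb] at hcard
    split_ifs at hcard <;> omega
  | k + 2 =>
    let j : Fin A.p := ⟨k, by omega⟩
    have hmem : A.type j.succ.succ ∈ L.map .plain := h.2.2 ▸ List.mem_ofFn.2 ⟨j, rfl⟩
    rw [type_of_two_le (by simp), if_pos (c := A.homog j.succ.succ = true) hhom] at hmem
    simp at hmem

theorem countLT_idx_of_ofFn_type {a b : Entry} {L : List ℕ}
    (h : List.ofFn A.type = a :: b :: L.map .plain) (k : ℕ) :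
    countLT A.idx (k + 2) = a.abs + b.abs + (L.take k).sum + 1 := by
  have habs : List.ofFn (fun t => (A.type t).abs) = a.abs :: b.abs :: L := by
    rw [← Function.comp_def, ← List.map_ofFn, h, List.map_cons, List.map_cons, List.map_map]
    congr 2
    exact List.map_id L
  rw [countLT_idx (by omega), segSum_zero_left, habs, List.take_succ_cons, List.take_succ_cons,
    List.sum_cons, List.sum_cons, add_assoc a.abs b.abs]

theorem idx_zero_eq_one_of_type_one {i : ℕ} (h : A.type 1 = .circ i) : A.idx 0 = 1 := by
  by_contra h0
  simp [type_one, h0] at h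

theorem idx_eq_one_iff (h : A.type 1 = .circ 0) (z : Fin (n + 1)) : A.idx z = 1 ↔ z = 0 := by
  have h0 := idx_zero_eq_one_of_type_one h
  refine ⟨fun hz => ?_, fun hz => hz ▸ h0⟩
  have hcard : #(A.block 1) ≤ 1 := by simp [card_block, h, h0, Entry.abs]
  exact card_le_one.1 hcard z (mem_block_iff.2 hz) 0 (mem_block_iff.2 h0)

/-- The type of `A` is the composition `a_{K - m_0}` of `Ω_m`, expressed by the numbers of elements
in the initial segments of `A`; here `g` is the index that goes with `K`. -/
structure IsTruncation (A : SkewedBinaryPartition n) (m : Fin (ℓ + 1) → ℕ) (K g : ℕ) : Prop where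
  isCut : IsCut m K g
  p_add : A.p + g = ℓ + 1
  not_homogAt : ∀ k, ¬ A.HomogAt k
  countLT_idx : ∀ k, countLT A.idx (k + 2) = max (segSum m 0 (g + k)) K + 1
  position_zero : K = m 0 ∧ (∀ z, A.idx 0 ≤ A.idx z) ∨ m 0 < K ∧ ∀ z, A.idx z = 1 ↔ z = 0

theorem exists_isTruncation_of_mem_Omega (hm : IsMultiplicityVector n m)
    (h : List.ofFn A.type ∈ Omega m) : ∃ K g, A.IsTruncation m K g := by
  obtain ⟨K, g, e, L, hL, hcut, hrem, hK⟩ := (mem_Omega_iff hm).1 h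
  have he : e.abs = 0 := by
    rcases hK with ⟨-, ⟨-, rfl⟩ | ⟨-, rfl⟩⟩ | ⟨-, rfl⟩ <;> rfl
  refine ⟨K, g, hcut, ?_, not_homogAt_of_ofFn_type hL he, fun k => ?_, ?_⟩
  · have hlen := congrArg List.length hL
    simp only [List.length_ofFn, List.length_cons, List.length_map, add_left_inj] at hlen
    rw [hlen, hrem.length_add]
  · rw [countLT_idx_of_ofFn_type hL, he, add_zero, ← hrem.add_sum_take, Entry.abs]
  · rw [ofFn_type, List.cons.injEq, List.cons.injEq] at hL
    obtain ⟨h0, h1, -⟩ := hL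
    rcases hK with ⟨rfl, ⟨-, rfl⟩ | ⟨hm0, rfl⟩⟩ | ⟨hK, rfl⟩
    · exact .inl ⟨rfl, fun z => (type_one_eq_plain_zero_iff.1 h1).trans_le zero_le⟩
    · refine .inl ⟨rfl, fun z => ?_⟩
      have hempty : #(A.block 0) = 0 := by
        simp [card_block, h0, hm0, Entry.abs, idx_zero_eq_one_of_type_one h1]
      rw [idx_zero_eq_one_of_type_one h1, Nat.one_le_iff_ne_zero]
      exact fun hz => eq_empty_iff_forall_notMem.1 (card_eq_zero.1 hempty) z (mem_block_iff.2 hz)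
    · exact .inr ⟨hK, idx_eq_one_iff h1⟩

theorem type_one_of_idx_eq_one_iff (h : ∀ z, A.idx z = 1 ↔ z = 0) : A.type 1 = .circ 0 := by
  have hblock : A.block 1 = {0} := by
    ext z
    rw [mem_block_iff, Fin.val_one, h, mem_singleton]
  rw [type_one, if_pos ((h 0).2 rfl), hblock, card_singleton]

theorem type_zero_eq_plain_abs (A : SkewedBinaryPartition n) :
    A.type 0 = .plain (A.type 0).abs := by
  rw [type_zero, Entry.abs]

namespace IsTruncation

theorem abs_type_zero_add (h : A.IsTruncation m K g) :
    (A.type 0).abs + (A.type 1).abs = K := by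
  have h0 := h.countLT_idx 0
  rw [countLT_idx_two, add_zero, max_eq_right h.isCut.segSum_le] at h0
  exact Nat.succ_injective h0

theorem type_one_of_forall_le (h : A.IsTruncation m (m 0) g) (hle : ∀ z, A.idx 0 ≤ A.idx z) :
    0 < m 0 ∧ A.type 1 = .plain 0 ∨ m 0 = 0 ∧ A.type 1 = .circ 0 := by
  have hsum := h.abs_type_zero_add
  obtain h0 | h1 := Nat.le_one_iff_eq_zero_or_eq_one.1 (idx_zero_le_one (B := A))
  · have hcard := (A.zero_mem_first (mem_block_iff.2 h0)).1
    rw [type_one_eq_plain_zero_iff.2 h0] at hsum ⊢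
    rw [card_block, if_pos (c := A.idx 0 = (0 : Fin (A.p + 2))) h0] at hcard
    exact .inl ⟨by rw [← hsum]; omega, rfl⟩
  · have hone (z) : A.idx z = 1 ↔ z = 0 := by
      refine ⟨fun hz => ?_, fun hz => hz ▸ h1⟩
      by_contra hne
      exact h.not_homogAt 1 (homogAt_one hz h1 hne)
    have hempty : A.block 0 = ∅ := eq_empty_iff_forall_notMem.2 fun z hz => by
      have h0 := hle z
      rw [mem_block_iff.1 hz, h1] at h0
      simp at h0
    have htype := type_one_of_idx_eq_one_iff hone
    rw [htype, type_zero, hempty] at hsum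
    exact .inr ⟨hsum.symm.trans (by simp [Entry.abs]), htype⟩

theorem type_mem_Omega (hm : IsMultiplicityVector n m) (h : A.IsTruncation m K g) :
    List.ofFn A.type ∈ Omega m := by
  have hsum := h.abs_type_zero_add
  have hL := ofFn_type_of_forall_not_homogAt h.not_homogAt
  have hone : (A.type 1).abs = 0 ∧
      (K = m 0 ∧ (0 < m 0 ∧ A.type 1 = .plain 0 ∨ m 0 = 0 ∧ A.type 1 = .circ 0) ∨
        m 0 < K ∧ A.type 1 = .circ 0) := by
    rcases h.position_zero with ⟨rfl, hle⟩ | ⟨hK, hone⟩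
    · have h1 := h.type_one_of_forall_le hle
      exact ⟨h1.elim (fun h => by rw [h.2, Entry.abs]) (fun h => by rw [h.2, Entry.abs]),
        .inl ⟨rfl, h1⟩⟩
    · have h1 := type_one_of_idx_eq_one_iff hone
      exact ⟨by rw [h1, Entry.abs], .inr ⟨hK, h1⟩⟩
  rw [hone.1, add_zero] at hsum
  refine (mem_Omega_iff hm).2 ⟨K, g, A.type 1, List.ofFn fun j : Fin A.p => #(A.block j.succ.succ),
    ?_, h.isCut, ⟨?_, fun k => ?_⟩, hone.2⟩
  · rw [hL, type_zero_eq_plain_abs, hsum]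
  · rw [List.length_ofFn, h.p_add]
  · have hk := h.countLT_idx k
    rw [countLT_idx_of_ofFn_type hL, hone.1, hsum, add_zero] at hk
    exact Nat.succ_injective hk

end IsTruncation

theorem mem_SBP_iff (hm : IsMultiplicityVector n m) {B : SkewedBinaryPartition n} :
    B ∈ SBP n m ↔ ∃ (A : SkewedBinaryPartition n) (K g : ℕ),
      A.IsTruncation m K g ∧ IsCoarsening A.idx B.idx B.HomogAt := by
  constructor
  · rintro ⟨A, hA, hB⟩
    obtain ⟨K, g, h⟩ := exists_isTruncation_of_mem_Omega hm hA
    exact ⟨A, K, g, h, (isContraction_rel_iff h.not_homogAt).1 hB⟩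
  · rintro ⟨A, K, g, h, hB⟩
    exact ⟨A, h.type_mem_Omega hm, (isContraction_rel_iff h.not_homogAt).2 hB⟩

/-! ### Necessity of the conditions -/

theorem two_le_idx_of_lt (h0 : ∀ z, A.idx 0 ≤ A.idx z) {x y : Fin (n + 1)}
    (hxy : A.idx x < A.idx y) : 2 ≤ A.idx y := by
  by_contra hy
  have := h0 x
  exact idx_ne_one (B := A) (by omega) y (by omega)

theorem exists_lt_idx_of_homogAt (hc : IsCoarsening A.idx B.idx B.HomogAt) {x : Fin (n + 1)}
    (hx : B.HomogAt (B.idx x)) :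
    ∃ u v, B.idx u = B.idx x ∧ B.idx v = B.idx x ∧ A.idx u < A.idx v := by
  obtain ⟨y, hy, hne⟩ := hc.spread hx
  rcases hne.lt_or_gt with hlt | hgt
  exacts [⟨y, x, hy, rfl, hlt⟩, ⟨x, y, rfl, hy, hgt⟩]

theorem idx_le_one_of_idx_le_one (hc : IsCoarsening A.idx B.idx B.HomogAt)
    (hone : ∀ z, A.idx z = 1 ↔ z = 0) {z : Fin (n + 1)} (hz : A.idx z ≤ 1) : B.idx z ≤ 1 := by
  rcases hz.lt_or_eq with hlt | heq
  · exact (hc.monotone (hlt.trans_eq ((hone 0).2 rfl).symm)).trans idx_zero_le_one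
  · exact (hone z).1 heq ▸ idx_zero_le_one

namespace IsTruncation

theorem countLT_two (h : A.IsTruncation m K g) : countLT A.idx 2 = K + 1 := by
  rw [h.countLT_idx 0, add_zero, max_eq_right h.isCut.segSum_le]

theorem lt_countLT_two (h : A.IsTruncation m K g) (hc : IsCoarsening A.idx B.idx B.HomogAt)
    (hone : ∀ z, A.idx z = 1 ↔ z = 0) : K < countLT B.idx 2 := by
  rw [Nat.lt_iff_add_one_le, ← h.countLT_two]
  exact countLT_le_countLT fun z hz =>
    Nat.lt_succ_of_le (idx_le_one_of_idx_le_one hc hone (Nat.le_of_lt_succ hz))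

theorem lt_countLT (h : A.IsTruncation m K g) (hc : IsCoarsening A.idx B.idx B.HomogAt)
    {v : Fin (n + 1)} (hv : 2 ≤ A.idx v) {k : ℕ} (hk : B.idx v < k) : K + 1 < countLT B.idx k := by
  rw [← h.countLT_two]
  exact countLT_lt_countLT (fun z hz => (hc.monotone (hz.trans_le hv)).trans_lt hk) hk hv

theorem two_le_idx_of_not_homogAt (h : A.IsTruncation m K g)
    (hc : IsCoarsening A.idx B.idx B.HomogAt) {x : Fin (n + 1)} (hx : 2 ≤ B.idx x)
    (hhom : ¬ B.HomogAt (B.idx x)) : 2 ≤ A.idx x := by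
  have hlt : B.idx 0 < B.idx x := idx_zero_le_one.trans_lt hx
  rcases h.position_zero with ⟨-, hle⟩ | ⟨-, hone⟩
  · refine two_le_idx_of_lt hle ((hle x).lt_of_ne fun heq => ?_)
    obtain ⟨w, hw, hne⟩ := hc.spread ((hc.homog heq hlt).resolve_right hhom)
    exact (hc.monotone (heq ▸ (hle w).lt_of_ne' hne)).not_gt (hw ▸ hlt)
  · by_contra hx'
    have := idx_le_one_of_idx_le_one hc hone (z := x) (by omega)
    omega

theorem fits_of_not_homogAt (h : A.IsTruncation m K g) (hc : IsCoarsening A.idx B.idx B.HomogAt)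
    {x : Fin (n + 1)} (hx : 2 ≤ B.idx x) (hhom : ¬ B.HomogAt (B.idx x)) :
    Fits m B.type (g + A.idx x - 2) (B.idx x - 1) := by
  obtain ⟨k, hk⟩ := Nat.exists_eq_add_of_le' (h.two_le_idx_of_not_homogAt hc hx hhom)
  have hp := h.p_add
  have hg := h.isCut.one_le
  have hk' := idx_lt (B := A) x
  have hbelow : countLT A.idx (k + 2) ≤ countLT B.idx (B.idx x) := countLT_le_countLT fun z hz =>
    (hc.le (hz.trans_eq hk.symm)).resolve_right fun heq => hhom (heq.1 ▸ heq.2)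
  have habove : countLT B.idx (B.idx x + 1) ≤ countLT A.idx (k + 3) :=
    countLT_le_countLT fun z hz => by
      by_contra hz'
      rcases hc.le (x := x) (y := z) (by omega) with hxz | hxz
      exacts [by omega, hhom hxz.2]
  rw [h.countLT_idx] at hbelow
  rw [h.countLT_idx (k + 1), max_eq_left (h.isCut.le_segSum_add_succ k)] at habove
  rw [fits_idx_sub_one_iff hx, hk, show g + (k + 2) - 2 = g + k by omega]
  exact ⟨⟨by omega, by omega⟩, (Nat.lt_succ_of_le (le_max_left _ K)).trans_le hbelow, habove⟩

theorem exists_countLT_le_segSum_lt (h : A.IsTruncation m K g)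
    (hc : IsCoarsening A.idx B.idx B.HomogAt) {x : Fin (n + 1)} (hx : 2 ≤ B.idx x)
    (hhom : B.HomogAt (B.idx x)) :
    ∃ k, countLT B.idx (B.idx x) ≤ segSum m 0 k ∧
      segSum m 0 k + 1 < countLT B.idx (B.idx x + 1) := by
  obtain ⟨u, v, hu, hv, huv⟩ := exists_lt_idx_of_homogAt hc hhom
  have hv2 : 2 ≤ A.idx v := by
    rcases h.position_zero with ⟨-, hle⟩ | ⟨-, hone⟩
    · exact two_le_idx_of_lt hle huv
    · by_contra hv'
      have := idx_le_one_of_idx_le_one hc hone (z := v) (by omega)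
      omega
  obtain ⟨k, hk⟩ := Nat.exists_eq_add_of_le' hv2
  have hbelow : countLT B.idx (B.idx x) < countLT A.idx (k + 2) := by
    refine countLT_lt_countLT (fun z hz => ?_) (huv.trans_eq hk) hu.ge
    by_contra hz'
    exact (hc.monotone (x := u) (y := z) (by omega)).not_gt (hu ▸ hz)
  have habove : countLT A.idx (k + 2) < countLT B.idx (B.idx x + 1) :=
    countLT_lt_countLT (fun z hz => Nat.lt_succ_of_le (hv ▸ hc.monotone (hz.trans_eq hk.symm)))
      (hv ▸ Nat.lt_succ_self _) hk.ge
  have hK : K ≤ segSum m 0 (g + k) := by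
    rcases h.position_zero with ⟨rfl, -⟩ | ⟨-, hone⟩
    · rw [← segSum_zero_one m]
      exact segSum_zero_mono m (h.isCut.one_le.trans (Nat.le_add_right _ _))
    · have := h.lt_countLT_two hc hone
      have := countLT_mono B.idx hx
      rw [h.countLT_idx] at hbelow
      omega
  rw [h.countLT_idx, max_eq_left hK] at hbelow habove
  exact ⟨g + k, Nat.le_of_lt_succ hbelow, habove⟩

theorem not_fits_of_homogAt (h : A.IsTruncation m K g) (hc : IsCoarsening A.idx B.idx B.HomogAt)
    {x : Fin (n + 1)} (hx : 2 ≤ B.idx x) (hhom : B.HomogAt (B.idx x)) (i : ℕ) :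
    ¬ Fits m B.type i (B.idx x - 1) := by
  obtain ⟨k, hk, hk'⟩ := h.exists_countLT_le_segSum_lt hc hx hhom
  rw [fits_idx_sub_one_iff hx]
  rintro ⟨-, hl, hr⟩
  have hi : i < k := (segSum_zero_mono m).reflect_lt (by omega)
  have hi' : k < i + 1 := (segSum_zero_mono m).reflect_lt (by omega)
  omega

theorem exists_fits_iff (h : A.IsTruncation m K g)
    (hc : IsCoarsening A.idx B.idx B.HomogAt) {x : Fin (n + 1)} (hx : 2 ≤ B.idx x) :
    (∃ i, Fits m B.type i (B.idx x - 1)) ↔ ¬ B.HomogAt (B.idx x) :=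
  ⟨fun ⟨i, hi⟩ hhom => h.not_fits_of_homogAt hc hx hhom i hi,
    fun hhom => ⟨_, h.fits_of_not_homogAt hc hx hhom⟩⟩

theorem fits_unique_right (h : A.IsTruncation m K g) (hc : IsCoarsening A.idx B.idx B.HomogAt)
    {i j j' : ℕ} (hj : Fits m B.type i j) (hj' : Fits m B.type i j') : j = j' := by
  have key {j} (hj : Fits m B.type i j) : ∃ x, B.idx x = j + 1 ∧ ¬ B.HomogAt (B.idx x) ∧
      A.idx x + g = i + 2 := by
    obtain ⟨-, ⟨hj1, hjp⟩, -⟩ := id hj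
    obtain ⟨x, hx⟩ := exists_idx_eq (B := B) (k := j + 1) (by omega) (by omega)
    have hxj : j = B.idx x - 1 := by omega
    have hhom : ¬ B.HomogAt (B.idx x) := fun hhom =>
      h.not_fits_of_homogAt hc (by omega) hhom i (hxj ▸ hj)
    have hi := (h.fits_of_not_homogAt hc (by omega) hhom).unique_left (hxj ▸ hj)
    have := h.two_le_idx_of_not_homogAt hc (by omega) hhom
    exact ⟨x, hx, hhom, by omega⟩
  obtain ⟨x, hx, hhom, hxi⟩ := key hj
  obtain ⟨x', hx', hhom', hxi'⟩ := key hj'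
  rcases lt_trichotomy (B.idx x) (B.idx x') with hlt | heq | hgt
  · exact absurd (hc.lt_of_not_homog hlt hhom hhom') (by omega)
  · omega
  · exact absurd (hc.lt_of_not_homog hgt hhom' hhom) (by omega)

theorem exists_two_le_idx_le_two (h : A.IsTruncation m K g)
    (hc : IsCoarsening A.idx B.idx B.HomogAt) (hle : ∀ z, A.idx 0 ≤ A.idx z) (hK : K < n) :
    ∃ v, 2 ≤ A.idx v ∧ B.idx v ≤ 2 := by
  by_cases hp : B.p = 0
  · have hcount : countLT A.idx 2 ≠ n + 1 := by rw [h.countLT_two]; omega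
    have hex : ∃ v, 2 ≤ A.idx v := by
      by_contra! hall
      exact hcount (by simp [countLT, hall])
    obtain ⟨v, hv⟩ := hex
    have := idx_lt (B := B) v
    exact ⟨v, hv, by omega⟩
  · obtain ⟨x, hx⟩ := exists_idx_eq (B := B) le_rfl (by omega)
    by_cases hhom : B.HomogAt (B.idx x)
    · obtain ⟨u, v, -, hv, huv⟩ := exists_lt_idx_of_homogAt hc hhom
      exact ⟨v, two_le_idx_of_lt hle huv, (hv.trans hx).le⟩
    · exact ⟨x, h.two_le_idx_of_not_homogAt hc hx.ge hhom, hx.le⟩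

theorem lt_countLT_three (h : A.IsTruncation m K g) (hc : IsCoarsening A.idx B.idx B.HomogAt)
    (hn : m 0 < n) : m 0 + 1 < countLT B.idx 3 := by
  rcases h.position_zero with ⟨rfl, hle⟩ | ⟨hK, hone⟩
  · obtain ⟨v, hv, hv'⟩ := h.exists_two_le_idx_le_two hc hle hn
    exact h.lt_countLT hc hv (Nat.lt_succ_of_le hv')
  · have := h.lt_countLT_two hc hone
    have := countLT_mono B.idx (show 2 ≤ 3 by omega)
    omega

theorem lt_countLT_two_of_idx_zero (h : A.IsTruncation m K g)
    (hc : IsCoarsening A.idx B.idx B.HomogAt) (h0 : B.idx 0 = 1) (hlt : 1 < countLT B.idx 2) :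
    m 0 + 1 < countLT B.idx 2 := by
  rcases h.position_zero with ⟨rfl, hle⟩ | ⟨hK, hone⟩
  · suffices hv : ∃ v, A.idx 0 < A.idx v ∧ B.idx v < 2 from
      let ⟨v, hv, hv'⟩ := hv
      h.lt_countLT hc (two_le_idx_of_lt hle hv) hv'
    by_cases hhom : B.HomogAt 1
    · obtain ⟨v, hv, hne⟩ := hc.spread (h0.symm ▸ hhom)
      exact ⟨v, (hle v).lt_of_ne' hne, by omega⟩
    · obtain ⟨z, hz, hz0⟩ := exists_mem_ne hlt 0
      have hz2 : B.idx z < 2 := (mem_filter.1 hz).2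
      have hz1 : B.idx z ≠ 1 := fun hz1 => hhom (homogAt_one hz1 h0 hz0)
      refine ⟨z, (hle z).lt_of_ne' fun heq => ?_, hz2⟩
      have hzidx : B.idx z = 0 := by omega
      have := hc.homog heq (by omega)
      rw [hzidx, h0] at this
      exact this.elim not_homogAt_zero hhom
  · have := h.lt_countLT_two hc hone
    omega

theorem countLT_two_le_of_idx_zero (h : A.IsTruncation m K g)
    (hc : IsCoarsening A.idx B.idx B.HomogAt) (h0 : B.idx 0 = 0) :
    countLT B.idx 2 ≤ m 0 + 1 := by
  have hnot (z) : ¬ A.idx z < A.idx 0 := fun hz => by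
    rcases hc.le hz with hlt | ⟨heq, hhom⟩
    · omega
    · rw [heq, h0] at hhom
      exact not_homogAt_zero hhom
  rcases h.position_zero with ⟨rfl, -⟩ | ⟨hK, hone⟩
  · rw [← h.countLT_two]
    refine countLT_le_countLT fun z hz => ?_
    by_contra hz'
    have hz1 := idx_ne_one h0 z
    have := idx_zero_le_one (B := A)
    rcases hc.le (x := 0) (y := z) (by omega) with hlt | ⟨-, hhom⟩
    · omega
    · rw [h0] at hhom
      exact not_homogAt_zero hhom
  · have hcard : 1 < countLT A.idx 2 := by rw [h.countLT_two]; omega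
    obtain ⟨z, hz, hz0⟩ := exists_mem_ne hcard 0
    have hz2 : A.idx z < 2 := (mem_filter.1 hz).2
    have hz1 : A.idx z ≠ 1 := fun hz1 => hz0 ((hone z).1 hz1)
    have := (hone 0).2 rfl
    exact absurd (by omega) (hnot z)

theorem countLT_two_iff (h : A.IsTruncation m K g) (hc : IsCoarsening A.idx B.idx B.HomogAt) :
    1 < countLT B.idx 2 ∧ countLT B.idx 2 ≤ m 0 + 1 ↔ B.idx 0 = 0 := by
  refine ⟨fun ⟨hlt, hle⟩ => ?_, fun h0 => ⟨?_, h.countLT_two_le_of_idx_zero hc h0⟩⟩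
  · by_contra h0
    have := idx_zero_le_one (B := B)
    exact hle.not_gt (h.lt_countLT_two_of_idx_zero hc (by omega) hlt)
  · have hcard := (B.zero_mem_first (mem_block_iff.2 h0)).1
    rw [block_eq_filter] at hcard
    exact hcard.trans (card_le_card (monotone_filter_right _ fun z _ hz => by simp [hz]))

end IsTruncation

/-! ### Sufficiency of the conditions -/

theorem exists_idx_eq_forall_not_homogAt {p : ℕ} {f : Fin (n + 1) → ℕ} (hlt : ∀ z, f z < p + 2)
    (hsurj : ∀ k, 2 ≤ k → k < p + 2 → ∃ z, f z = k) (hzero : f 0 ≤ 1)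
    (hfirst : f 0 = 0 → (∃ z ≠ 0, f z = 0) ∧ ∀ z, f z ≠ 1) (hsecond : ∀ z, f z = 1 → z = 0) :
    ∃ A : SkewedBinaryPartition n, A.p = p ∧ A.idx = f ∧ ∀ k, ¬ A.HomogAt k := by
  let block (i : Fin (p + 2)) : Finset (Fin (n + 1)) := {z | f z = i}
  have hmem {i z} : z ∈ block i ↔ f z = i := mem_filter_univ _
  let A : SkewedBinaryPartition n :=
    { p := p
      block := block
      homog := fun _ => false
      disjoint := fun i j hij => disjoint_filter.2 fun z _ hi hj => hij (Fin.ext (hi.symm.trans hj))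
      cover := fun z => ⟨⟨f z, hlt z⟩, hmem.2 rfl⟩
      first_nonhomog := rfl
      second_homog := fun h => by
        obtain ⟨x, hx, y, hy, hne⟩ := one_lt_card.1 h
        exact absurd ((hsecond x (hmem.1 hx)).trans (hsecond y (hmem.1 hy)).symm) hne
      zero_mem := (Nat.le_one_iff_eq_zero_or_eq_one.1 hzero).imp hmem.2 hmem.2
      zero_mem_first := fun h => by
        obtain ⟨⟨z, hz, hz'⟩, hne⟩ := hfirst (hmem.1 h)
        exact ⟨one_lt_card.2 ⟨z, hmem.2 hz', 0, h, hz⟩, filter_eq_empty_iff.2 fun z _ => hne z⟩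
      small_nonhomog := fun _ _ => rfl
      nonempty := fun i hi => (hsurj i hi i.isLt).imp fun z => hmem.2 }
  exact ⟨A, rfl, funext fun z => mem_block_iff (B := A) (i := ⟨f z, hlt z⟩).1 (hmem.2 rfl),
    fun k ⟨_, hk⟩ => Bool.noConfusion hk⟩

theorem exists_idx_lt_add_two_iff {p : ℕ} {L : Fin (n + 1) → ℕ} (hle : ∀ z, L z ≤ p)
    (hsurj : ∀ k < p, ∃ z, L z = k + 1) (hzero : L 0 = 0) {isolated : Prop}
    (hfirst : ¬ isolated → ∃ z ≠ 0, L z = 0) :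
    ∃ A : SkewedBinaryPartition n, A.p = p ∧ (∀ k, ¬ A.HomogAt k) ∧
      (∀ z k, A.idx z < k + 2 ↔ L z < k + 1) ∧ (isolated → ∀ z, A.idx z = 1 ↔ z = 0) ∧
      (¬ isolated → A.idx 0 = 0) := by
  classical
  let f (z : Fin (n + 1)) : ℕ := if L z = 0 then if z = 0 ∧ isolated then 1 else 0 else L z + 1
  have hf (z) (k : ℕ) : f z < k + 2 ↔ L z < k + 1 := by
    simp only [f]
    split_ifs <;> omega
  have hone (z) : f z = 1 ↔ z = 0 ∧ isolated := by grind
  have hzero' : ¬ isolated → f 0 = 0 := fun h => by simp [f, hzero, h]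
  have hfsurj (k) (hk : 2 ≤ k) (hk' : k < p + 2) : ∃ z, f z = k := by
    obtain ⟨k, rfl⟩ := Nat.exists_eq_add_of_le' hk
    obtain ⟨z, hz⟩ := hsurj k (by omega)
    exact ⟨z, by simp [f, hz]⟩
  have hffirst (h0 : f 0 = 0) : (∃ z ≠ 0, f z = 0) ∧ ∀ z, f z ≠ 1 := by
    have h : ¬ isolated := fun h => absurd ((hone 0).2 ⟨rfl, h⟩) (by omega)
    obtain ⟨z, hz, hLz⟩ := hfirst h
    exact ⟨⟨z, hz, by simp [f, hLz, h]⟩, fun z hz => h ((hone z).1 hz).2⟩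
  obtain ⟨A, hp, hA, hhom⟩ := exists_idx_eq_forall_not_homogAt (p := p)
    (fun z => (hf z p).2 (Nat.lt_succ_of_le (hle z))) hfsurj
    (Nat.le_of_lt_succ ((hf 0 0).2 (by omega))) hffirst fun z hz => ((hone z).1 hz).1
  exact ⟨A, hp, hhom, hA ▸ hf, fun h z => by simp [hA, hone, h], hA ▸ hzero'⟩

theorem level_zero_eq_zero {L : Fin (n + 1) → ℕ} (hLB : ∀ x y, L x < L y → B.idx x ≤ B.idx y)
    (hB : countLT B.idx 2 ≤ countLT L 1) : L 0 = 0 := by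
  by_contra h0
  exact hB.not_gt (countLT_lt_countLT (w := 0)
    (fun z hz => Nat.lt_succ_of_le ((hLB z 0 (by omega)).trans idx_zero_le_one))
    (Nat.lt_succ_of_le idx_zero_le_one) (by omega))

theorem exists_isTruncation (hm : IsMultiplicityVector n m) (hcut : IsCut m K g)
    (hB : countLT B.idx 2 ≤ K + 1) :
    ∃ A : SkewedBinaryPartition n, A.IsTruncation m K g ∧
      ∀ x y, A.idx x < A.idx y → 2 ≤ A.idx y → B.idx x ≤ B.idx y := by
  have hKn : K ≤ n := hm.segSum_eq le_rfl ▸ hcut.le_segSum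
  have hg := hcut.le_succ
  obtain ⟨L, hL, hLB⟩ := exists_levels B.idx (T := fun k => max (segSum m 0 (g + k)) K)
    (fun a b hab => max_le_max_right K (segSum_zero_mono m (Nat.add_le_add_left hab g)))
    ⟨ℓ + 1, (hm.segSum_eq (Nat.le_add_left _ g)).ge.trans (le_max_left _ _)⟩
  replace hL (k) : countLT L (k + 1) = max (segSum m 0 (g + k)) K + 1 :=
    hL k (max_le (hm.segSum_le _) hKn)
  have hL0 : countLT L 1 = K + 1 := by rw [hL 0, add_zero, max_eq_right hcut.segSum_le]
  have hzero : L 0 = 0 := level_zero_eq_zero hLB (hL0 ▸ hB)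
  have hfirst : ¬ (m 0 < K ∨ K = 0) → ∃ z ≠ 0, L z = 0 := fun h => by
    obtain ⟨z, hz, hne⟩ := exists_mem_ne (show 1 < countLT L 1 by omega) 0
    exact ⟨z, hne, by simpa using hz⟩
  obtain ⟨A, hAp, hhom, hA, hisol, hA0⟩ := exists_idx_lt_add_two_iff (p := ℓ + 1 - g)
    (fun z => Nat.le_sub_of_add_le (level_add_le hm hcut hL z))
    (fun k hk => exists_level_eq hm hcut hL (by omega)) hzero hfirst
  refine ⟨A, ⟨hcut, by omega, hhom, fun k => ?_, ?_⟩, fun x y hxy hy => hLB x y ?_⟩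
  · rw [← hL, countLT, countLT]
    simp only [hA]
  · rcases hcut.apply_zero_le.lt_or_eq with hK | rfl
    · exact .inr ⟨hK, hisol (.inl hK)⟩
    · refine .inl ⟨rfl, fun z => ?_⟩
      by_cases h0 : m 0 = 0
      · have hz : L z ≠ 0 ∨ z = 0 := or_iff_not_imp_left.2 fun hz =>
          card_le_one.1 (hL0.trans_le (by omega)) z (by simpa using hz) 0 (by simpa using hzero)
        rcases hz with hz | rfl
        · have := hA z 0
          have := idx_zero_le_one (B := A)
          omega
        · exact le_rfl
      · exact (hA0 (by omega)).trans_le (Nat.zero_le _)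
  · obtain ⟨k, hk⟩ := Nat.exists_eq_add_of_le' hy
    exact ((hA x k).1 (hxy.trans_eq hk)).trans_le (by have := hA y k; omega)

theorem forall_isPos_and_isPosStar_iff :
    (∀ j : Fin B.p, ((∃ i, Fits m B.type i (j + 1)) → (B.type j.succ.succ).IsPos) ∧
      ((¬ ∃ i, Fits m B.type i (j + 1)) → (B.type j.succ.succ).IsPosStar)) ↔
    ∀ x, 2 ≤ B.idx x → ((∃ i, Fits m B.type i (B.idx x - 1)) ↔ ¬ B.HomogAt (B.idx x)) := by
  simp only [isPos_type_iff, isPosStar_type_iff]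
  constructor
  · intro h x hx
    obtain ⟨j, hj⟩ := Nat.exists_eq_add_of_le' hx
    have hjp : j < B.p := by have := idx_lt (B := B) x; omega
    have := h ⟨j, hjp⟩
    rw [hj, show j + 2 - 1 = j + 1 by omega]
    exact ⟨this.1, not_imp_comm.1 this.2⟩
  · intro h j
    obtain ⟨x, hx⟩ := exists_idx_eq (B := B) (k := j + 2) (by omega) (by omega)
    have := h x (by omega)
    rw [hx, show j.val + 2 - 1 = j + 1 by omega] at this
    exact ⟨this.1, not_imp_comm.1 this.2⟩

/-- A truncation `A` from which `B` is to be obtained by contractions: `A` orders the elements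
compatibly with `B`, except inside its first two blocks, and the initial segment of these two blocks
is the smallest one of a truncation that contains the first two blocks of `B`. -/
structure IsAdaptedTruncation (A B : SkewedBinaryPartition n) (m : Fin (ℓ + 1) → ℕ) (K g : ℕ) : Prop
    extends IsTruncation A m K g where
  idx_le_idx : ∀ ⦃x y⦄, A.idx x < A.idx y → 2 ≤ A.idx y → B.idx x ≤ B.idx y
  add_one_eq : K + 1 = max (m 0 + 1) (countLT B.idx 2)

namespace IsAdaptedTruncation

theorem countLT_le (h : A.IsAdaptedTruncation B m K g) : countLT B.idx 2 ≤ K + 1 :=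
  h.add_one_eq ▸ le_max_right _ _

theorem lt_countLT_idx_succ (h : A.IsAdaptedTruncation B m K g)
    (h3 : m 0 + 1 < countLT B.idx 3) {x : Fin (n + 1)} (hx : 2 ≤ B.idx x) :
    K + 1 < countLT B.idx (B.idx x + 1) :=
  h.add_one_eq.trans_lt (max_lt (h3.trans_le (countLT_mono B.idx (Nat.succ_le_succ hx)))
    ((countLT_mono B.idx hx).trans_lt (countLT_idx_lt_succ x)))

theorem idx_le_one (h : A.IsAdaptedTruncation B m K g) {x : Fin (n + 1)} (hx : B.idx x ≤ 1) :
    A.idx x ≤ 1 := by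
  by_contra! hx'
  refine (h.countLT_two ▸ h.countLT_le).not_gt (countLT_lt_countLT (w := x) (fun z hz => ?_)
    (Nat.lt_succ_of_le hx) hx')
  exact Nat.lt_succ_of_le ((h.idx_le_idx (hz.trans_le hx') hx').trans hx)

theorem idx_le_one_of_lt (h : A.IsAdaptedTruncation B m K g) (hK : m 0 < K) {x : Fin (n + 1)}
    (hx : A.idx x ≤ 1) : B.idx x ≤ 1 := by
  by_contra! hx'
  have hcount : countLT B.idx 2 < countLT A.idx 2 := countLT_lt_countLT
    (fun z hz => Nat.lt_succ_of_le (h.idx_le_one (Nat.le_of_lt_succ hz))) (Nat.lt_succ_of_le hx) hx'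
  have := h.add_one_eq
  rw [h.countLT_two] at hcount
  omega

theorem add_idx_of_fits (h : A.IsAdaptedTruncation B m K g)
    (h3 : m 0 + 1 < countLT B.idx 3) {x : Fin (n + 1)}
    (hx : 2 ≤ B.idx x) {i : ℕ} (hi : Fits m B.type i (B.idx x - 1)) :
    2 ≤ A.idx x ∧ g + A.idx x = i + 2 := by
  obtain ⟨⟨hi1, -⟩, hl, hr⟩ := (fits_idx_sub_one_iff hx).1 hi
  have hKx := h.lt_countLT_idx_succ h3 hx
  have hg : g < i + 1 := (segSum_zero_mono m).reflect_lt
    (h.isCut.segSum_le.trans_lt (by omega))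
  obtain ⟨k, rfl⟩ := Nat.exists_eq_add_of_le (Nat.le_of_lt_succ hg)
  have hbelow : countLT A.idx (k + 2) ≤ countLT B.idx (B.idx x) := by
    have hm0 : m 0 ≤ segSum m 0 (g + k) := segSum_zero_one m ▸ segSum_zero_mono m hi1
    have := countLT_mono B.idx hx
    have := h.add_one_eq
    rw [h.countLT_idx]
    omega
  have habove : countLT B.idx (B.idx x + 1) ≤ countLT A.idx (k + 3) := by
    rw [h.countLT_idx (k + 1)]
    exact hr.trans (Nat.succ_le_succ (le_max_left _ _))
  have hlt : k + 2 ≤ A.idx x := by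
    by_contra! hlt
    refine hbelow.not_gt (countLT_lt_countLT (fun z hz => ?_) hlt le_rfl)
    by_contra! hz'
    exact (h.idx_le_idx (hlt.trans_le hz') (by omega)).not_gt hz
  have hgt : A.idx x < k + 3 := by
    by_contra! hgt
    exact habove.not_gt (countLT_lt_countLT (fun z hz => Nat.lt_succ_of_le
      (h.idx_le_idx (hz.trans_le hgt) (by omega))) (Nat.lt_succ_self _) hgt)
  omega

theorem fits_of_forall_idx_eq (h : A.IsAdaptedTruncation B m K g)
    (h3 : m 0 + 1 < countLT B.idx 3) {x : Fin (n + 1)}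
    (hx : 2 ≤ B.idx x) (hconst : ∀ y, B.idx y = B.idx x → A.idx y = A.idx x) :
    Fits m B.type (g + A.idx x - 2) (B.idx x - 1) := by
  have hpos {z} (hz : B.idx z ≤ B.idx x) (hz2 : 2 ≤ A.idx z) : A.idx z ≤ A.idx x := by
    by_contra! hlt
    exact hlt.ne' (hconst z (hz.antisymm (h.idx_le_idx hlt hz2)))
  have hx2 : 2 ≤ A.idx x := by
    by_contra! hx2
    refine (h.lt_countLT_idx_succ h3 hx).not_ge (h.countLT_two ▸ countLT_le_countLT fun z hz => ?_)
    by_contra! hz2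
    exact hz2.not_gt ((hpos (Nat.le_of_lt_succ hz) hz2).trans_lt hx2)
  have hbelow : countLT A.idx (A.idx x) ≤ countLT B.idx (B.idx x) := countLT_le_countLT fun z hz =>
    (h.idx_le_idx hz hx2).lt_of_ne fun heq => hz.ne (hconst z heq)
  have habove : countLT B.idx (B.idx x + 1) ≤ countLT A.idx (A.idx x + 1) :=
    countLT_le_countLT fun z hz => by
      by_contra! hz'
      exact (hpos (Nat.le_of_lt_succ hz) (by omega)).not_gt hz'
  have hxp := idx_lt (B := A) x
  have hg := h.isCut.one_le
  have hp := h.p_add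
  obtain ⟨k, hk⟩ := Nat.exists_eq_add_of_le' hx2
  rw [hk, h.countLT_idx] at hbelow
  rw [hk, h.countLT_idx (k + 1), max_eq_left (h.isCut.le_segSum_add_succ k)] at habove
  rw [fits_idx_sub_one_iff hx, hk, show g + (k + 2) - 2 = g + k by omega]
  exact ⟨⟨by omega, by omega⟩, (Nat.lt_succ_of_le (le_max_left _ K)).trans_le hbelow, habove⟩

theorem idx_eq_one_iff_of_one_lt (h : A.IsAdaptedTruncation B m K g)
    (h2 : 1 < countLT B.idx 2 ∧ countLT B.idx 2 ≤ m 0 + 1 ↔ B.idx 0 = 0)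
    (h0 : B.idx 0 = 1) (hlt : 1 < countLT B.idx 2) (z : Fin (n + 1)) : A.idx z = 1 ↔ z = 0 := by
  have hnot : ¬ countLT B.idx 2 ≤ m 0 + 1 := fun hle => by
    have := h2.1 ⟨hlt, hle⟩
    omega
  rcases h.position_zero with ⟨rfl, -⟩ | ⟨-, hone⟩
  · have := h.add_one_eq
    omega
  · exact hone z

theorem lt_or_homogAt_of_idx_lt (h : A.IsAdaptedTruncation B m K g)
    (h2 : 1 < countLT B.idx 2 ∧ countLT B.idx 2 ≤ m 0 + 1 ↔ B.idx 0 = 0)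
    (h3 : m 0 + 1 < countLT B.idx 3)
    (hfits : ∀ x, 2 ≤ B.idx x → ¬ B.HomogAt (B.idx x) → ∃ i, Fits m B.type i (B.idx x - 1))
    {x y : Fin (n + 1)} (hxy : A.idx x < A.idx y) :
    B.idx x < B.idx y ∨ B.idx x = B.idx y ∧ B.HomogAt (B.idx x) := by
  rcases le_or_gt 2 (A.idx y) with hy | hy
  · refine (h.idx_le_idx hxy hy).lt_or_eq.imp_right fun heq => ⟨heq, ?_⟩
    by_contra hhom
    have hx2 : 2 ≤ B.idx x := by
      by_contra! hx
      have := h.idx_le_one (x := y) (by omega)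
      omega
    obtain ⟨i, hi⟩ := hfits x hx2 hhom
    have := h.add_idx_of_fits h3 hx2 hi
    have := h.add_idx_of_fits h3 (heq ▸ hx2) (heq ▸ hi)
    omega
  · rcases h.position_zero with ⟨-, hle⟩ | ⟨hK0, hone⟩
    · exact absurd (two_le_idx_of_lt hle hxy) hy.not_ge
    · obtain rfl := (hone y).1 (by omega)
      have hx : x ≠ 0 := fun hx => hxy.ne (hx ▸ rfl)
      have hbx := h.idx_le_one_of_lt hK0 (x := x) (by omega)
      have h0 : B.idx 0 ≠ 0 := fun h0 => by
        have := h2.2 h0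
        have := h.add_one_eq
        omega
      have h01 := idx_zero_le_one (B := B)
      rcases hbx.lt_or_eq with hbx | hbx
      · exact .inl (by omega)
      · exact .inr ⟨by omega, hbx ▸ homogAt_one hbx (by omega) hx⟩

theorem homogAt_or_homogAt_of_idx_eq (h : A.IsAdaptedTruncation B m K g)
    (h2 : 1 < countLT B.idx 2 ∧ countLT B.idx 2 ≤ m 0 + 1 ↔ B.idx 0 = 0)
    (h3 : m 0 + 1 < countLT B.idx 3)
    (hfits : ∀ x, 2 ≤ B.idx x → ¬ B.HomogAt (B.idx x) → ∃ i, Fits m B.type i (B.idx x - 1))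
    (huniq : ∀ i j j', Fits m B.type i j → Fits m B.type i j' → j = j')
    {x y : Fin (n + 1)} (heq : A.idx x = A.idx y) (hlt : B.idx x < B.idx y) :
    B.HomogAt (B.idx x) ∨ B.HomogAt (B.idx y) := by
  by_contra! hhom
  rcases le_or_gt 2 (B.idx y) with hy | hy
  · obtain ⟨i, hi⟩ := hfits y hy hhom.2
    have hiy := h.add_idx_of_fits h3 hy hi
    rcases le_or_gt 2 (B.idx x) with hx | hx
    · obtain ⟨i', hi'⟩ := hfits x hx hhom.1
      have hix := h.add_idx_of_fits h3 hx hi'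
      obtain rfl : i = i' := by omega
      have := huniq i _ _ hi hi'
      omega
    · have := h.idx_le_one (Nat.le_of_lt_succ hx)
      omega
  · have hy1 : B.idx y = 1 := by omega
    have h0 := idx_zero_eq_one hy1
    have hcard : 1 < countLT B.idx 2 := one_lt_card.2
      ⟨x, by simpa using hlt.trans hy, y, by simpa using hy, fun hxy => hlt.ne (hxy ▸ rfl)⟩
    have hone := h.idx_eq_one_iff_of_one_lt h2 h0 hcard
    obtain rfl | hne := eq_or_ne y 0
    · have := (hone x).1 (heq.trans ((hone 0).2 rfl))
      exact hlt.ne (this ▸ rfl)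
    · exact hhom.2 (hy1 ▸ homogAt_one hy1 h0 hne)

theorem exists_idx_ne_of_homogAt (h : A.IsAdaptedTruncation B m K g)
    (h2 : 1 < countLT B.idx 2 ∧ countLT B.idx 2 ≤ m 0 + 1 ↔ B.idx 0 = 0)
    (h3 : m 0 + 1 < countLT B.idx 3)
    (hfits : ∀ x, 2 ≤ B.idx x → (∃ i, Fits m B.type i (B.idx x - 1)) → ¬ B.HomogAt (B.idx x))
    {x : Fin (n + 1)} (hx : B.HomogAt (B.idx x)) : ∃ y, B.idx y = B.idx x ∧ A.idx y ≠ A.idx x := by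
  by_contra! hconst
  rcases le_or_gt 2 (B.idx x) with hx2 | hx2
  · exact hfits x hx2 ⟨_, h.fits_of_forall_idx_eq h3 hx2 hconst⟩ hx
  · have hx0 : B.idx x ≠ 0 := fun hx0 => not_homogAt_zero (hx0 ▸ hx)
    have hx1 : B.idx x = 1 := by omega
    have h0 := idx_zero_eq_one hx1
    obtain ⟨y, hne, hy⟩ := exists_ne_of_homogAt hx
    have hcard : 1 < countLT B.idx 2 := one_lt_card.2
      ⟨x, by simpa using hx2, y, by simpa [hy] using hx2, hne.symm⟩
    have hone := h.idx_eq_one_iff_of_one_lt h2 h0 hcard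
    have hx' : x = 0 := (hone x).1 ((hconst 0 (h0.trans hx1.symm)).symm.trans ((hone 0).2 rfl))
    have hy' : y = 0 := (hone y).1 ((hconst y hy).trans ((hone x).2 hx'))
    exact hne (hy'.trans hx'.symm)

theorem isCoarsening (h : A.IsAdaptedTruncation B m K g)
    (h2 : 1 < countLT B.idx 2 ∧ countLT B.idx 2 ≤ m 0 + 1 ↔ B.idx 0 = 0)
    (h3 : m 0 + 1 < countLT B.idx 3)
    (huniq : ∀ i j j', Fits m B.type i j → Fits m B.type i j' → j = j')
    (hfits : ∀ x, 2 ≤ B.idx x →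
      ((∃ i, Fits m B.type i (B.idx x - 1)) ↔ ¬ B.HomogAt (B.idx x))) :
    IsCoarsening A.idx B.idx B.HomogAt where
  le _ _ := h.lt_or_homogAt_of_idx_lt h2 h3 fun x hx => (hfits x hx).2
  spread _ := h.exists_idx_ne_of_homogAt h2 h3 fun x hx => (hfits x hx).1
  homog _ _ := h.homogAt_or_homogAt_of_idx_eq h2 h3 (fun x hx => (hfits x hx).2) huniq

end IsAdaptedTruncation

theorem exists_isAdaptedTruncation (hm : IsMultiplicityVector n m) (B : SkewedBinaryPartition n) :
    ∃ A K g, IsAdaptedTruncation A B m K g := by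
  obtain ⟨K, hK⟩ : ∃ K, K + 1 = max (m 0 + 1) (countLT B.idx 2) :=
    Nat.exists_add_one_eq.2 (by omega)
  have hcard : countLT B.idx 2 ≤ n + 1 := (card_le_univ _).trans_eq (Fintype.card_fin _)
  have hm0 := hm.apply_zero_lt
  obtain ⟨g, hcut⟩ := exists_isCut hm (K := K) (by omega) (by omega)
  obtain ⟨A, hA, hle⟩ := exists_isTruncation hm hcut (B := B) (by omega)
  exact ⟨A, K, g, hA, hle, hK⟩

end SkewedBinaryPartition

end ParkingFan

theorem mainTheorem5 (n ℓ : ℕ) (m : Fin (ℓ + 1) → ℕ)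
    (hm : ParkingFan.IsMultiplicityVector n m) (B : ParkingFan.SkewedBinaryPartition n) :
    B ∈ ParkingFan.SBP n m ↔
      ParkingFan.IsSkewedBinaryComposition n B.type ∧
      -- (1) `0 < |b_{-1}| + |b_0| ≤ m_0` iff `b_0 = 0` (the plain zero)
      ((0 < (B.type 0).abs + (B.type 1).abs ∧ (B.type 0).abs + (B.type 1).abs ≤ m 0) ↔
        B.type 1 = .plain 0) ∧
      -- (2) `m_0 < |b_{-1}| + |b_0| + |b_1|` (without `|b_1|` when `p = 0`), and at most one `j`
      -- fits for each `i`
      (m 0 < ParkingFan.segSum (fun t => (B.type t).abs) 0 3 ∧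
        ∀ i j j' : ℕ, ParkingFan.Fits m B.type i j → ParkingFan.Fits m B.type i j' → j = j') ∧
      -- (3) `b_j` is plain if `j` fits for some `i`, and starred otherwise
      (∀ j : Fin B.p,
        ((∃ i, ParkingFan.Fits m B.type i (j + 1)) → (B.type j.succ.succ).IsPos) ∧
        ((¬ ∃ i, ParkingFan.Fits m B.type i (j + 1)) → (B.type j.succ.succ).IsPosStar)) := by
  open ParkingFan SkewedBinaryPartition in
  rw [mem_SBP_iff hm, and_iff_right isSkewedBinaryComposition_type, type_one_eq_plain_zero_iff,
    forall_isPos_and_isPosStar_iff, ← Nat.add_lt_add_iff_right (k := 1),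
    ← Nat.add_le_add_iff_right (n := 1), ← Nat.add_lt_add_iff_right (k := 1) (n := m 0), zero_add,
    ← countLT_idx_two, ← countLT_idx (by omega : 2 ≤ 3)]
  constructor
  · rintro ⟨A, K, g, h, hc⟩
    exact ⟨h.countLT_two_iff hc, ⟨h.lt_countLT_three hc hm.apply_zero_lt,
      fun _ _ _ => h.fits_unique_right hc⟩, fun _ => h.exists_fits_iff hc⟩
  · rintro ⟨h2, ⟨h3, huniq⟩, hfits⟩
    obtain ⟨A, K, g, h⟩ := exists_isAdaptedTruncation hm B
    exact ⟨A, K, g, h.toIsTruncation, h.isCoarsening h2 h3 huniq hfits⟩
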